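/- **Setting.** Let $d\ge2$, $T>0$, $[d]=\{1,\dots,d\}$, $\|\cdot\|$ the Euclidean norm on $\mathbb R^d$, $e_1,\dots,e_d$ its standard basis, $e_{yz}=e_z-e_y$, $\mathcal P=\{\eta\in\mathbb R_+^d:\sum_x\eta_x=1\}$, and $\mathcal P^{m}=\{\eta\in\mathcal P: m\eta\in\mathbb Z^d\}$. For $x\in[d]$ let $\mathbb R^d_x=\{a\in\mathbb R^d: a_y\ge0\ (y\ne x),\ a_x=-\sum_{y\ne x}a_y\}$, and for $\phi:[d]\to\mathbb R$ let $\Delta_x\phi=(\phi(l)-\phi(x))_{l\in[d]}$. Given a running cost $f(x,\eta,a)$ and a terminal cost $g(x,\eta)$, put $h(x,\eta,a,p)=f(x,\eta,a)+\sum_{y\ne x}a_yp_y$ and $H(x,\eta,p)=\inf_{a\in\mathbb R^d_x}h(x,\eta,a,p)$. **Assumptions.** (A1) For all $x\in[d]$, $\eta\in\mathcal P$, $p\in\mathbb R^d$, the function $h(x,\eta,\cdot,p)$ has a unique minimizer $a^*(x,\eta,p)$ in $\mathbb R^d_x$, and $a^*$ is measurable. (A2) (i) $U:[0,T]\times[d]\times\mathcal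 P\to\mathbb R$ is a classical solution (continuous, differentiable in $t$ and in $\eta$) of the master equation $$-\partial_tU(t,x,\eta)=\sum_{y,z}\partial_{\eta_z}U(t,x,\eta)\,\eta_y\,a^*_z(y,\eta,\Delta_yU(t,\cdot,\eta))+H(x,\eta,\Delta_xU(t,\cdot,\eta)),\qquad U(T,x,\eta)=g(x,\eta),$$ where $\nabla_\eta U$ is a gradient relative to $\mathcal P$. For every $n\ge2$, $V^n:[0,T]\times[d]\times\mathcal P^{n-1}\to\mathbb R$ is a classical (differentiable in $t$) solution of $$-\partial_tV^n(t,x,\eta)=\sum_{y,z}\eta_y\,D^{n,y,z}V^n(t,x,\eta)\,a^*_z\big(y,\eta^{yx},\Delta_yV^n(t,\cdot,\eta^{yx})\big)+H(x,\eta,\Delta_xV^n(t,\cdot,\eta)),\qquad V^n(T,x,\eta)=g(x,\eta),$$ where $\eta^{yx}=\eta+\frac1{n-1}e_{yx}$, $D^{n,y,z}\phi(\eta)=(n-1)\big(\phi(\eta+\frac1{n-1}e_{yz})-\phi(\eta)\big)$, and terms with $\eta_y=0$ are zero. (ii) $\nabla_\eta U$ is bounded, and Lipschitz in $\eta$ uniformly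 in $(t,x)$. Let $c_U=\sup|U|$. For some $K>2c_U$ and all $\eta,\eta'\in\mathcal P$ and $p,p'\in[-K,K]^d$: (iii) $\|a^*(x,\eta,p)-a^*(x,\eta',p')\|\le c_L(\|\eta-\eta'\|+\|p-p'\|)$ for all $x$, and $a^*_y(x,\eta,p)\ge\kappa$ for all $y\ne x$, with a constant $c_L$ and a constant $\kappa>0$; (iv) $|H(x,\eta,p)-H(x,\eta,p')|\le c_L\|p-p'\|$ for all $x$. **Coupling.** For $n\ge2$ let $X=(X^{n,i})_{i\in[n]}$ and $Y=(Y^{n,i})_{i\in[n]}$ be càdlàg $[d]^n$-valued processes on $[0,T]$, on a probability space with a filtration. The variables $X^{n,i}(0)$, $i\in[n]$, are i.i.d. and $Y(0)=X(0)$. Let $$\mu^{n,i}=\frac1{n-1}\sum_{j\ne i}e_{X^{n,j}},\quad \nu^{n,i}=\frac1{n-1}\sum_{j\ne i}e_{Y^{n,j}},\quad \mu^n=\frac1n\sum_{j}e_{X^{n,j}},\quad \nu^n=\frac1n\sum_{j}e_{Y^{n,j}},$$ and $$a^{X,i}_z(t)=\max\{0,a^*_z(X^{n,i}(t-),\mu^{n,i}(t-),\Delta_{X^{n,i}(t-)}V^n(t,\cdot,\mu^{n,i}(t-)))\},$$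 $$a^{Y,i}_z(t)=\max\{0,a^*_z(Y^{n,i}(t-),\nu^{n,i}(t-),\Delta_{Y^{n,i}(t-)}U(t,\cdot,\nu^{n,i}(t-)))\}.$$ Pairs of different players never jump at the same time. Up to $\tau^{n,i}=\inf\{t:X^{n,i}(t)\ne Y^{n,i}(t)\}$ the pair $(X^{n,i},Y^{n,i})$ jumps, for each $z\in[d]$, to $(z,z)$ at rate $\min\{a^{X,i}_z,a^{Y,i}_z\}$, to $(z,Y^{n,i}(t-))$ at rate $a^{X,i}_z-\min\{a^{X,i}_z,a^{Y,i}_z\}$, and to $(X^{n,i}(t-),z)$ at rate $a^{Y,i}_z-\min\{a^{X,i}_z,a^{Y,i}_z\}$. After $\tau^{n,i}$ the two components jump independently, to $z$ at the rates $a^{X,i}_z$ and $a^{Y,i}_z$. (The jump rates are understood in the sense of the martingale problem for $(X,Y,(1_{\{\tau^{n,i}\le t\}})_{i})$.) **Proposition 2.1.** Under (A1) and (A2) there is $C>0$ such that for every $n\ge2$, every such coupling and every $i\in[n]$, $$\mathbb E\Big[\sup_{s\in[0,T]}\|\mu^{n,i}(s)-\nu^{n,i}(s)\|\Big]\le2\,\mathbb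 E\Big[\sup_{s\in[0,T]}|X^{n,i}(s)-Y^{n,i}(s)|\Big]\le\frac Cn$$ and $$\mathbb E\Big[\sup_{s\in[0,T]}\|\mu^{n}(s)-\nu^{n}(s)\|\Big]\le\frac{C+2}n.$$ Moreover, for every sequence of such couplings, one for each $n\ge 2$, $\sqrt n\,\sup_{s\in[0,T]}\|\mu^n(s)-\nu^n(s)\|\to0$ in probability as $n\to\infty$. -/

import Mathlib

open MeasureTheory ProbabilityTheory Filter Topology Set
open scoped ENNReal

noncomputable section

namespace FiniteGame

/-- `ℝ^d` with the Euclidean norm, coordinates indexed by the `d` states. -/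
abbrev Vec (d : ℕ) := EuclideanSpace ℝ (Fin d)

/-- The vector `e_x` of the standard basis. -/
def basisVec {d : ℕ} (x : Fin d) : Vec d := EuclideanSpace.single x 1

/-- `e_{yz} = e_z - e_y`. -/
def moveVec {d : ℕ} (y z : Fin d) : Vec d := basisVec z - basisVec y

/-- The probability vectors on the `d` states. -/
def simplex (d : ℕ) : Set (Vec d) := {η | (∀ x, 0 ≤ η x) ∧ ∑ x, η x = 1}

/-- The possible empirical measures of `m` players: probability vectors `η` such that `m η` has
nonnegative integer entries. -/
def lattice (d m : ℕ) : Set (Vec d) := {η | η ∈ simplex d ∧ ∀ x, ∃ k : ℕ, (m : ℝ) * η x = k}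

/-- The admissible rates out of state `x`: nonnegative off the entry `x`, and summing to zero. -/
def rateVecs {d : ℕ} (x : Fin d) : Set (Vec d) :=
  {a | (∀ y, y ≠ x → 0 ≤ a y) ∧ a x = -∑ y ∈ Finset.univ.erase x, a y}

/-- The vector `Δ_x φ = (φ l - φ x)_l`. -/
def increments {d : ℕ} (x : Fin d) (φ : Fin d → ℝ) : Vec d := WithLp.toLp 2 fun l => φ l - φ x

/-- `h(x, η, a, p) = f(x, η, a) + ∑_{y ≠ x} a_y p_y`. -/
def preHamiltonian {d : ℕ} (f : Fin d → Vec d → Vec d → ℝ) (x : Fin d) (η a p : Vec d) : ℝ :=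
  f x η a + ∑ y ∈ Finset.univ.erase x, a y * p y

/-- The Hamiltonian, the infimum of `h(x, η, a, p)` over the admissible rates `a` out of `x`. -/
def hamiltonian {d : ℕ} (f : Fin d → Vec d → Vec d → ℝ) (x : Fin d) (η p : Vec d) : ℝ :=
  sInf ((fun a => preHamiltonian f x η a p) '' rateVecs x)

/-- `astar` is the measurable function whose value at `(x, η, p)` is the one and only minimizer of
the Hamiltonian. The entry `x` is normalized by membership in `rateVecs x`. -/
structure IsUniqueMinimizer {d : ℕ} (f : Fin d → Vec d → Vec d → ℝ)
    (astar : Fin d → Vec d → Vec d → Vec d) : Prop where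
  measurable : ∀ x, Measurable fun q : simplex d × Vec d => astar x q.1 q.2
  mem : ∀ x, ∀ η ∈ simplex d, ∀ p, astar x η p ∈ rateVecs x
  lt : ∀ x, ∀ η ∈ simplex d, ∀ p, ∀ a ∈ rateVecs x, a ≠ astar x η p →
    preHamiltonian f x η (astar x η p) p < preHamiltonian f x η a p

/-- The difference operator
`D^{n,y,z} φ(η) = (n - 1) (φ(η + e_{yz} / (n - 1)) - φ(η))`. -/
def diffQuot {d : ℕ} (n : ℕ) (y z : Fin d) (φ : Vec d → ℝ) (η : Vec d) : ℝ :=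
  ((n : ℝ) - 1) * (φ (η + (1 / ((n : ℝ) - 1)) • moveVec y z) - φ η)

/-- `V` is a classical solution of the Hamilton-Jacobi-Bellman system of the symmetric `n`-player
game on `[0, T]`. The measure argument ranges over the empirical measures of the other `n - 1`
players. Terms with `η y = 0` vanish, so only values of `V` at such measures enter. -/
structure SolvesHJB {d : ℕ} (T : ℝ) (f : Fin d → Vec d → Vec d → ℝ) (g : Fin d → Vec d → ℝ)
    (astar : Fin d → Vec d → Vec d → Vec d) (n : ℕ) (V : ℝ → Fin d → Vec d → ℝ) : Prop where
  deriv : ∀ t ∈ Icc 0 T, ∀ x, ∀ η ∈ lattice d (n - 1),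
    HasDerivWithinAt (fun s => V s x η)
      (-((∑ y, ∑ z, η y * diffQuot n y z (V t x) η *
            astar y (η + (1 / ((n : ℝ) - 1)) • moveVec y x)
              (increments y fun l => V t l (η + (1 / ((n : ℝ) - 1)) • moveVec y x)) z)
          + hamiltonian f x η (increments x fun l => V t l η)))
      (Icc 0 T) t
  terminal : ∀ x, ∀ η ∈ lattice d (n - 1), V T x η = g x η

/-- `U` is a classical solution of the master equation on `[0, T]`, and `gradU` is its gradient in
the measure argument, relative to the simplex. Such a gradient is determined up to multiples of
`(1, …, 1)`, which do not affect the equation since the entries of `astar` sum to zero. -/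
structure SolvesMaster {d : ℕ} (T : ℝ) (f : Fin d → Vec d → Vec d → ℝ) (g : Fin d → Vec d → ℝ)
    (astar : Fin d → Vec d → Vec d → Vec d) (U : ℝ → Fin d → Vec d → ℝ)
    (gradU : ℝ → Fin d → Vec d → Vec d) : Prop where
  continuousOn : ∀ x, ContinuousOn (fun q : ℝ × Vec d => U q.1 x q.2) (Icc 0 T ×ˢ simplex d)
  gradient : ∀ t ∈ Icc 0 T, ∀ x, ∀ η ∈ simplex d,
    HasGradientWithinAt (U t x) (gradU t x η) (simplex d) η
  deriv : ∀ t ∈ Icc 0 T, ∀ x, ∀ η ∈ simplex d,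
    HasDerivWithinAt (fun s => U s x η)
      (-((∑ y, ∑ z, gradU t x η z * η y * astar y η (increments y fun l => U t l η) z)
          + hamiltonian f x η (increments x fun l => U t l η)))
      (Icc 0 T) t
  terminal : ∀ x, ∀ η ∈ simplex d, U T x η = g x η

/-- `c_U`, the supremum of `|U|`. -/
def supAbs {d : ℕ} (T : ℝ) (U : ℝ → Fin d → Vec d → ℝ) : ℝ :=
  sSup {r | ∃ t ∈ Icc 0 T, ∃ x, ∃ η ∈ simplex d, r = |U t x η|}

/-- The cube `[-K, K]^d`. -/
def cube (d : ℕ) (K : ℝ) : Set (Vec d) := {p | ∀ y, |p y| ≤ K}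

/-- The regularity assumptions: classical solutions of all the equations, a bounded gradient of `U`
that is Lipschitz in the measure, `astar` and the Hamiltonian Lipschitz for `p` in a cube slightly
larger than `[-2 c_U, 2 c_U]^d`, transition rates bounded away from zero there. -/
structure RegularityAssumption {d : ℕ} (T : ℝ) (f : Fin d → Vec d → Vec d → ℝ)
    (g : Fin d → Vec d → ℝ) (astar : Fin d → Vec d → Vec d → Vec d)
    (V : ℕ → ℝ → Fin d → Vec d → ℝ) (U : ℝ → Fin d → Vec d → ℝ)
    (gradU : ℝ → Fin d → Vec d → Vec d) : Prop where
  hjb : ∀ n, 2 ≤ n → SolvesHJB T f g astar n (V n)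
  master : SolvesMaster T f g astar U gradU
  gradient_bounded : ∃ c : ℝ, ∀ t ∈ Icc 0 T, ∀ x, ∀ η ∈ simplex d, ‖gradU t x η‖ ≤ c
  gradient_lipschitz : ∃ c : ℝ, ∀ t ∈ Icc 0 T, ∀ x, ∀ η ∈ simplex d, ∀ η' ∈ simplex d,
    ‖gradU t x η - gradU t x η'‖ ≤ c * ‖η - η'‖
  local_regularity : ∃ K : ℝ, 2 * supAbs T U < K ∧
    (∃ c : ℝ, ∀ x, ∀ η ∈ simplex d, ∀ η' ∈ simplex d, ∀ p ∈ cube d K, ∀ p' ∈ cube d K,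
      ‖astar x η p - astar x η' p'‖ ≤ c * (‖η - η'‖ + ‖p - p'‖)) ∧
    (∃ κ : ℝ, 0 < κ ∧ ∀ x y, x ≠ y → ∀ η ∈ simplex d, ∀ p ∈ cube d K, κ ≤ astar x η p y) ∧
    (∃ c : ℝ, ∀ x, ∀ η ∈ simplex d, ∀ p ∈ cube d K, ∀ p' ∈ cube d K,
      |hamiltonian f x η p - hamiltonian f x η p'| ≤ c * ‖p - p'‖)

/-- The empirical measure of all players but player `i` in the configuration `c`. -/
def othersMeasure {n d : ℕ} (c : Fin n → Fin d) (i : Fin n) : Vec d :=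
  (1 / ((n : ℝ) - 1)) • ∑ j ∈ Finset.univ.erase i, basisVec (c j)

/-- The empirical measure of all players in the configuration `c`. -/
def fullMeasure {n d : ℕ} (c : Fin n → Fin d) : Vec d := (1 / (n : ℝ)) • ∑ j, basisVec (c j)

/-- The rate at which player `i` moves to state `z` at time `t` in the configuration `c`, when it
uses the control built from the function `W`:
`max 0 (astar_z (c i, m, Δ_{c i} W(t, ·, m)))`, with `m` the empirical measure of the others. -/
def playerRate {n d : ℕ} (astar : Fin d → Vec d → Vec d → Vec d) (W : ℝ → Fin d → Vec d → ℝ)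
    (t : ℝ) (c : Fin n → Fin d) (i : Fin n) (z : Fin d) : ℝ :=
  max 0 (astar (c i) (othersMeasure c i) (increments (c i) fun l => W t l (othersMeasure c i)) z)

/-- The state of the coupled games: the configurations of the two games, and for every player
whether its two copies have already been apart. -/
abbrev CoupledState (n d : ℕ) := (Fin n → Fin d) × (Fin n → Fin d) × (Fin n → Bool)

/-- The generator of the coupled games at time `t`, applied to `φ`, at the state `σ`. As long as
the two copies of player `i` have not been apart, they jump together to `z` at the rate
`min (aX z) (aY z)`, and only the first (second) one jumps to `z` at the rate by which `aX z`
(`aY z`) exceeds this minimum. Afterwards the two copies jump independently, at the rates `aX` and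
`aY`. -/
def couplingGenerator {n d : ℕ} (astar : Fin d → Vec d → Vec d → Vec d)
    (V U : ℝ → Fin d → Vec d → ℝ) (t : ℝ) (φ : CoupledState n d → ℝ) (σ : CoupledState n d) : ℝ :=
  let x := σ.1
  let y := σ.2.1
  let b := σ.2.2
  ∑ i, ∑ z,
    let aX := playerRate astar V t x i z
    let aY := playerRate astar U t y i z
    let x' := Function.update x i z
    let y' := Function.update y i z
    let b' := Function.update b i true
    if b i = false then
      min aX aY * (φ (x', y', b) - φ σ)
        + (aX - min aX aY) * (φ (x', y, b') - φ σ)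
        + (aY - min aX aY) * (φ (x, y', b') - φ σ)
    else
      aX * (φ (x', y, b) - φ σ) + aY * (φ (x, y', b) - φ σ)

open Classical in
/-- The state of the coupled games at time `t`. The flag of player `i` says that
`X s i ≠ Y s i` for some `s ∈ [0, t]`, that is, `τ^{n,i} ≤ t`. -/
def coupledState {n d : ℕ} {Ω : Type*} (X Y : ℝ → Ω → Fin n → Fin d) (t : ℝ) (ω : Ω) :
    CoupledState n d :=
  (X t ω, Y t ω, fun i => decide (∃ s ∈ Icc 0 t, X s ω i ≠ Y s ω i))

/-- The paths of `X` on `[0, T]` are right-continuous with left limits (for the discrete topology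
on the finite set of configurations). -/
def HasCadlagPaths {n d : ℕ} {Ω : Type*} (T : ℝ) (X : ℝ → Ω → Fin n → Fin d) : Prop :=
  ∀ ω, (∀ t ∈ Ico 0 T, ∀ᶠ s in 𝓝[>] t, X s ω = X t ω) ∧
    ∀ t ∈ Ioc 0 T, ∃ c, ∀ᶠ s in 𝓝[<] t, X s ω = c

/-- `(X, Y)` is the coupling on `[0, T]` of the `n`-player game driven by `V` (configuration `X`)
with the one driven by `U` (configuration `Y`): the two games start from the same i.i.d. states, and
the coupled process solves the martingale problem of the coupling generator. -/
structure IsCoupling {n d : ℕ} {Ω : Type*} [mΩ : MeasurableSpace Ω] (P : Measure Ω) (T : ℝ)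
    (astar : Fin d → Vec d → Vec d → Vec d) (V U : ℝ → Fin d → Vec d → ℝ)
    (ℱ : Filtration (Icc (0 : ℝ) T) mΩ) (X Y : ℝ → Ω → Fin n → Fin d) : Prop where
  adapted_X : ∀ t : Icc (0 : ℝ) T, Measurable[ℱ t] (X t)
  adapted_Y : ∀ t : Icc (0 : ℝ) T, Measurable[ℱ t] (Y t)
  cadlag_X : HasCadlagPaths T X
  cadlag_Y : HasCadlagPaths T Y
  initial_indep : iIndepFun (fun i ω => X 0 ω i) P
  initial_ident : ∀ i j, IdentDistrib (fun ω => X 0 ω i) (fun ω => X 0 ω j) P P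
  initial_eq : ∀ ω, Y 0 ω = X 0 ω
  martingale : ∀ φ : CoupledState n d → ℝ,
    Martingale (fun (t : Icc (0 : ℝ) T) ω =>
      φ (coupledState X Y t ω) - φ (coupledState X Y 0 ω)
        - ∫ s in (0 : ℝ)..t, couplingGenerator astar V U s φ (coupledState X Y s ω)) ℱ P

/-- The distance `|x - y|` of two states, as numbers. -/
def stateDist {d : ℕ} (x y : Fin d) : ℝ := |((x : ℕ) : ℝ) - ((y : ℕ) : ℝ)|

/-- `sup_{s ∈ [0, T]} ‖μ^{n,i}(s) - ν^{n,i}(s)‖`. -/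
def supOthersDist {n d : ℕ} {Ω : Type*} (T : ℝ) (X Y : ℝ → Ω → Fin n → Fin d) (i : Fin n)
    (ω : Ω) : ℝ≥0∞ :=
  ⨆ s ∈ Icc 0 T, ENNReal.ofReal ‖othersMeasure (X s ω) i - othersMeasure (Y s ω) i‖

/-- `sup_{s ∈ [0, T]} |X^{n,i}(s) - Y^{n,i}(s)|`. -/
def supStateDist {n d : ℕ} {Ω : Type*} (T : ℝ) (X Y : ℝ → Ω → Fin n → Fin d) (i : Fin n)
    (ω : Ω) : ℝ≥0∞ :=
  ⨆ s ∈ Icc 0 T, ENNReal.ofReal (stateDist (X s ω i) (Y s ω i))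

/-- `sup_{s ∈ [0, T]} ‖μ^n(s) - ν^n(s)‖`. -/
def supFullDist {n d : ℕ} {Ω : Type*} (T : ℝ) (X Y : ℝ → Ω → Fin n → Fin d) (ω : Ω) : ℝ≥0∞ :=
  ⨆ s ∈ Icc 0 T, ENNReal.ofReal ‖fullMeasure (X s ω) - fullMeasure (Y s ω)‖

end FiniteGame

end

namespace FiniteGame

/-! Every distance in the statement is governed by the events `apart X Y T j` that the two copies of
player `j` ever differ. A separated player moves the empirical measures by at most `2 / (n - 1)` or
`2 / n`, and two distinct states have distance between `1` and `d`. It therefore suffices that these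
events have probability `O(1 / n)`, the same for all players.

The first ingredient is `|V n - U| = O(1 / n)` on the lattice
(`UniformBounds.exists_abs_value_sub_le`), a maximum principle. Where `s (V n - U)`, `s = ±1`, is
largest over states and lattice points, its difference quotients are nonpositive and the rates
multiplying them nonnegative. Hence the quotients of `V n`, for which no bound is known, may be
exchanged for those of `U`, and these agree with the gradient of `U` up to `O(1 / n)`
(`UniformBounds.drift_sub_le`). A barrier `exp (B (T - t)) / (n - 1)` then dominates `|V n - U|`
backward from the terminal time, where both functions equal `g` (`lt_of_backward_barrier`). For
large `n` the barrier stays below the margin `δ` within which the local Lipschitz estimates are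
valid.

The second ingredient is the coupling. Until separation the copies of player `i` share a state and
part at the rate `∑ z, |aX z - aY z|` (`couplingGenerator_flag`), at most a constant times the
proportion of separated players plus `sup |V n - U|`. After taking expectations, exchangeability
turns this proportion into the separation probability of player `i` itself, and Grönwall's
inequality closes the estimate (`UniformBounds.measureReal_apart_le`). Exchangeability is derived:
the law of the coupled process and its relabelling solve the same finite linear forward equation
with the same initial law, so they agree (`IsCoupling.stateProb_permuteState`). -/

/-! ### Grönwall's inequality, a backward barrier, joint measurability -/

/-- A Grönwall bound for bounded functions, with no measurability required. -/
theorem le_two_mul_exp_of_le_integral {w : ℝ → ℝ} {A C T M : ℝ} (hC : 0 ≤ C) (hT : 0 ≤ T)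
    (h0 : ∀ t ∈ Icc 0 T, 0 ≤ w t) (hM : ∀ t ∈ Icc 0 T, w t ≤ M)
    (h : ∀ t ∈ Icc 0 T, w t ≤ A + C * ∫ s in (0 : ℝ)..t, w s) :
    ∀ t ∈ Icc 0 T, w t ≤ 2 * A * Real.exp (2 * C * t) := by
  have hzero : (0 : ℝ) ∈ Icc 0 T := ⟨le_rfl, hT⟩
  have hA : 0 ≤ A := by
    have := h 0 hzero
    simp only [intervalIntegral.integral_same, mul_zero, add_zero] at this
    exact (h0 0 hzero).trans this
  -- In the norm with weight `exp (-2Ct)` the map `w ↦ C ∫ w` contracts by the factor `1/2`. The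
  -- finite supremum `K` then satisfies `K ≤ A + K / 2`, that is `K ≤ 2A`.
  set S := (fun t => Real.exp (-(2 * C * t)) * w t) '' Icc 0 T with hS
  have hne : S.Nonempty := ⟨_, 0, hzero, rfl⟩
  have hM0 : 0 ≤ M := (h0 0 hzero).trans (hM 0 hzero)
  have hbdd : BddAbove S := by
    refine ⟨M, ?_⟩
    rintro _ ⟨t, ht, rfl⟩
    have : Real.exp (-(2 * C * t)) ≤ 1 :=
      Real.exp_le_one_iff.2 (neg_nonpos.2 (mul_nonneg (by positivity) ht.1))
    calc Real.exp (-(2 * C * t)) * w t ≤ 1 * w t := mul_le_mul_of_nonneg_right this (h0 t ht)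
      _ ≤ M := by rw [one_mul]; exact hM t ht
  set K := sSup S with hK
  have hwK : ∀ t ∈ Icc 0 T, w t ≤ K * Real.exp (2 * C * t) := by
    intro t ht
    have h1 : Real.exp (-(2 * C * t)) * w t ≤ K := le_csSup hbdd ⟨t, ht, rfl⟩
    rw [Real.exp_neg, inv_mul_le_iff₀ (Real.exp_pos _)] at h1
    linarith
  have hK0 : 0 ≤ K := by
    have := hwK 0 hzero
    simp only [mul_zero, Real.exp_zero, mul_one] at this
    exact (h0 0 hzero).trans this
  have hint : ∀ t ∈ Icc 0 T, C * ∫ s in (0 : ℝ)..t, w s ≤ K / 2 * Real.exp (2 * C * t) := by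
    intro t ht
    have h1 : ∫ s in (0 : ℝ)..t, w s ≤ ∫ s in (0 : ℝ)..t, K * Real.exp (2 * C * s) := by
      rw [intervalIntegral.integral_of_le ht.1, intervalIntegral.integral_of_le ht.1]
      -- Only the larger function has to be integrable here, so `w` may be non-measurable.
      refine integral_mono_of_nonneg ?_ ?_ ?_
      · filter_upwards [ae_restrict_mem measurableSet_Ioc] with s hs
        exact h0 s ⟨hs.1.le, hs.2.trans ht.2⟩
      · exact (Continuous.integrableOn_Icc (by fun_prop)).mono_set Ioc_subset_Icc_self
      · filter_upwards [ae_restrict_mem measurableSet_Ioc] with s hs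
        exact hwK s ⟨hs.1.le, hs.2.trans ht.2⟩
    have h2 : ∫ s in (0 : ℝ)..t, C * (K * Real.exp (2 * C * s))
        = K / 2 * Real.exp (2 * C * t) - K / 2 * Real.exp (2 * C * 0) := by
      refine intervalIntegral.integral_eq_sub_of_hasDerivAt
        (f := fun s => K / 2 * Real.exp (2 * C * s)) (fun s _ => ?_)
        (Continuous.intervalIntegrable (by fun_prop) _ _)
      have := (((hasDerivAt_id s).const_mul (2 * C)).exp).const_mul (K / 2)
      refine this.congr_deriv ?_
      simp only [id]; ring
    rw [intervalIntegral.integral_const_mul] at h2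
    have h3 := mul_le_mul_of_nonneg_left h1 hC
    rw [h2] at h3
    have : 0 ≤ K / 2 * Real.exp (2 * C * 0) := by positivity
    linarith
  have hKle : K ≤ A + K / 2 := by
    refine csSup_le hne ?_
    rintro _ ⟨t, ht, rfl⟩
    have h1 : w t ≤ A + K / 2 * Real.exp (2 * C * t) := (h t ht).trans (by
      have := hint t ht; linarith)
    have h2 : 1 ≤ Real.exp (2 * C * t) :=
      Real.one_le_exp (mul_nonneg (by positivity) ht.1)
    change Real.exp (-(2 * C * t)) * w t ≤ _
    rw [Real.exp_neg, inv_mul_le_iff₀ (Real.exp_pos _)]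
    nlinarith
  intro t ht
  refine (hwK t ht).trans (mul_le_mul_of_nonneg_right (by linarith) (Real.exp_pos _).le)

/-- A backward comparison principle for finitely many functions: they stay below `ψ` if they end
below `ψ` and the first of them to touch `ψ` from below, backward in time, would have to cross it
upwards in forward time. -/
theorem lt_of_backward_barrier {ι : Type*} [Finite ι] {T : ℝ} {W W' : ι → ℝ → ℝ}
    {ψ ψ' : ℝ → ℝ}
    (hW : ∀ k, ∀ t ∈ Icc 0 T, HasDerivWithinAt (W k) (W' k t) (Icc 0 T) t)
    (hψ : ∀ t, HasDerivAt ψ (ψ' t) t) (hend : ∀ k, W k T < ψ T)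
    (step : ∀ t ∈ Icc 0 T, (∀ l, W l t ≤ ψ t) → ∀ k, W k t = ψ t → ψ' t < W' k t) :
    ∀ k, ∀ t ∈ Icc 0 T, W k t < ψ t := by
  by_contra! hcon
  obtain ⟨k₀, t₀, ht₀, hk₀⟩ := hcon
  have hcont : ∀ k, ContinuousOn (W k) (Icc 0 T) := fun k t ht => (hW k t ht).continuousWithinAt
  have hψc : Continuous ψ := continuous_iff_continuousAt.2 fun t => (hψ t).continuousAt
  set S : Set ℝ := ⋃ k, {t ∈ Icc 0 T | ψ t ≤ W k t} with hS
  have hcomp : IsCompact S := by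
    refine isCompact_iUnion fun k => ?_
    refine isCompact_Icc.of_isClosed_subset ?_ (sep_subset _ _)
    exact isClosed_Icc.isClosed_le hψc.continuousOn (hcont k)
  -- `τ` is the last time at which some `W k` reaches `ψ`. After `τ` all the functions lie strictly
  -- below `ψ`, while `step` makes `W k - ψ` increase from `0` just to the right of `τ`.
  obtain ⟨τ, hτS, hτ⟩ := hcomp.exists_isGreatest ⟨t₀, mem_iUnion.2 ⟨k₀, ht₀, hk₀⟩⟩
  obtain ⟨k, hτI, hk⟩ := mem_iUnion.1 hτS
  have hτT : τ < T := by
    refine lt_of_le_of_ne hτI.2 ?_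
    rintro rfl
    exact absurd hk (not_le.2 (hend k))
  have hafter : ∀ l, ∀ s ∈ Ioo τ T, W l s < ψ s := by
    intro l s hs
    by_contra! hle
    exact absurd (hτ (mem_iUnion.2 ⟨l, ⟨hτI.1.trans hs.1.le, hs.2.le⟩, hle⟩)) (not_le.2 hs.1)
  have hsub : Ioo τ T ⊆ Icc 0 T := fun s hs => ⟨hτI.1.trans hs.1.le, hs.2.le⟩
  have hmem : ∀ᶠ s in 𝓝[Ioo τ T] τ, s ∈ Ioo τ T := self_mem_nhdsWithin
  have : (𝓝[Ioo τ T] τ).NeBot := by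
    rw [nhdsWithin_Ioo_eq_nhdsGT hτT]; infer_instance
  have hle : ∀ l, W l τ ≤ ψ τ := by
    intro l
    refine le_of_tendsto_of_tendsto ((hcont l τ hτI).mono hsub)
      (hψc.continuousAt.continuousWithinAt (s := Ioo τ T)) ?_
    filter_upwards [hmem] with s hs using (hafter l s hs).le
  have heq : W k τ = ψ τ := le_antisymm (hle k) hk
  have hlt := step τ hτI hle k heq
  have hd : HasDerivWithinAt (fun s => W k s - ψ s) (W' k τ - ψ' τ) (Ioo τ T) τ :=
    ((hW k τ hτI).mono hsub).sub (hψ τ).hasDerivWithinAt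
  rw [hasDerivWithinAt_iff_tendsto_slope' (by simp)] at hd
  have hpos := hd.eventually (lt_mem_nhds (sub_pos.2 hlt))
  obtain ⟨s, hs, hsI⟩ := (hpos.and hmem).exists
  have h1 : 0 < (s - τ)⁻¹ * (W k s - ψ s - (W k τ - ψ τ)) := by
    simpa [slope_def_field, div_eq_inv_mul] using hs
  have h2 : W k s - ψ s < 0 := sub_neg.2 (hafter k s hsI)
  have h3 : 0 < (s - τ)⁻¹ := inv_pos.2 (sub_pos.2 hsI.1)
  rw [heq, sub_self, sub_zero] at h1
  exact absurd h1 (not_lt.2 (mul_nonpos_of_nonneg_of_nonpos h3.le h2.le))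

/-- A right-continuous process with values in a countable discrete space is jointly measurable. -/
theorem measurable_uncurry_of_eventually_eq {Ω E : Type*} [MeasurableSpace Ω] [MeasurableSpace E]
    [Countable E] [MeasurableSingletonClass E] {Z : ℝ → Ω → E} (hm : ∀ s, Measurable (Z s))
    (hr : ∀ ω s, ∀ᶠ r in 𝓝[>] s, Z r ω = Z s ω) :
    Measurable fun q : ℝ × Ω => Z q.1 q.2 := by
  -- The point of the grid of mesh `1 / (k + 1)` strictly to the right of `s`. Right-continuity
  -- makes `Z` at these points eventually equal to `Z s`, so each fibre of `Z` is a lower limit of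
  -- measurable sets.
  set a : ℕ → ℝ → ℝ := fun k s => ((⌊s * (k + 1)⌋ : ℝ) + 1) / (k + 1) with ha
  have hagt : ∀ k s, s < a k s := by
    intro k s
    have hk : (0 : ℝ) < k + 1 := by positivity
    rw [ha]
    simp only
    rw [lt_div_iff₀ hk]
    exact Int.lt_floor_add_one _
  have hale : ∀ k s, a k s ≤ s + 1 / ((k : ℝ) + 1) := by
    intro k s
    have hk : (0 : ℝ) < k + 1 := by positivity
    rw [ha]
    simp only
    rw [div_le_iff₀ hk, add_mul, one_div, inv_mul_cancel₀ hk.ne']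
    have := Int.floor_le (s * ((k : ℝ) + 1))
    linarith
  have hlim : ∀ s, Tendsto (fun k => a k s) atTop (𝓝[>] s) := by
    intro s
    refine tendsto_nhdsWithin_iff.2 ⟨?_, Eventually.of_forall fun k => hagt k s⟩
    refine tendsto_of_tendsto_of_tendsto_of_le_of_le tendsto_const_nhds ?_
      (fun k => (hagt k s).le) (fun k => hale k s)
    simpa using (tendsto_one_div_add_atTop_nhds_zero_nat (𝕜 := ℝ)).const_add s
  have hmk : ∀ k, Measurable fun q : ℝ × Ω => Z (a k q.1) q.2 := by
    intro k
    have h1 : Measurable fun q : ℤ × Ω => Z (((q.1 : ℝ) + 1) / (k + 1)) q.2 :=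
      measurable_from_prod_countable_right fun m => hm (((m : ℝ) + 1) / (k + 1))
    have h2 : Measurable fun q : ℝ × Ω => ((⌊q.1 * ((k : ℝ) + 1)⌋, q.2) : ℤ × Ω) :=
      (Int.measurable_floor.comp (measurable_fst.mul_const _)).prodMk measurable_snd
    exact h1.comp h2
  refine measurable_to_countable' fun c => ?_
  have heq : (fun q : ℝ × Ω => Z q.1 q.2) ⁻¹' {c}
      = ⋃ N : ℕ, ⋂ k : ℕ, ⋂ _ : N ≤ k, (fun q : ℝ × Ω => Z (a k q.1) q.2) ⁻¹' {c} := by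
    ext q
    have hev := (hlim q.1).eventually (hr q.2 q.1)
    obtain ⟨N, hN⟩ := eventually_atTop.1 hev
    simp only [mem_preimage, mem_singleton_iff, mem_iUnion, mem_iInter]
    constructor
    · intro hq
      exact ⟨N, fun k hk => (hN k hk).trans hq⟩
    · rintro ⟨N', hN'⟩
      rw [← hN (max N N') (le_max_left _ _), hN' _ (le_max_right _ _)]
  rw [heq]
  exact MeasurableSet.iUnion fun N => MeasurableSet.iInter fun k => MeasurableSet.iInter fun _ =>
    hmk k (measurableSet_singleton c)

/-! ### Vectors, the simplex and the lattice of empirical measures -/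

theorem norm_le_sum_abs {d : ℕ} (v : Vec d) : ‖v‖ ≤ ∑ i, |v i| := by
  rw [EuclideanSpace.norm_eq]
  refine Real.sqrt_le_iff.2 ⟨Finset.sum_nonneg fun i _ => abs_nonneg _, ?_⟩
  exact Finset.sum_sq_le_sq_sum_of_nonneg fun i _ => abs_nonneg _

theorem norm_basisVec {d : ℕ} (x : Fin d) : ‖basisVec x‖ = 1 := by
  simp [basisVec]

theorem norm_moveVec_le {d : ℕ} (y z : Fin d) : ‖moveVec y z‖ ≤ 2 := by
  refine (norm_sub_le _ _).trans ?_
  rw [norm_basisVec, norm_basisVec]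
  norm_num

theorem moveVec_self {d : ℕ} (y : Fin d) : moveVec y y = 0 := sub_self _

theorem moveVec_apply {d : ℕ} (y z w : Fin d) :
    moveVec y z w = (if w = z then 1 else 0) - (if w = y then 1 else 0) := by
  simp [moveVec, basisVec]

theorem inner_moveVec {d : ℕ} (v : Vec d) (y z : Fin d) :
    inner ℝ v (moveVec y z) = v z - v y := by
  simp [moveVec, basisVec, inner_sub_right, EuclideanSpace.inner_single_right]

theorem norm_increments_le {d : ℕ} (x : Fin d) {φ : Fin d → ℝ} {r : ℝ} (h : ∀ l, |φ l| ≤ r) :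
    ‖increments x φ‖ ≤ d * (2 * r) := by
  refine (norm_le_sum_abs _).trans ?_
  calc ∑ i, |increments x φ i| ≤ ∑ _i : Fin d, 2 * r := by
        refine Finset.sum_le_sum fun i _ => ?_
        change |φ i - φ x| ≤ _
        exact (abs_sub _ _).trans (by linarith [h i, h x])
    _ = d * (2 * r) := by simp

theorem increments_sub {d : ℕ} (x : Fin d) (φ φ' : Fin d → ℝ) :
    increments x φ - increments x φ' = increments x (fun l => φ l - φ' l) := by
  ext l
  simp only [increments, PiLp.sub_apply]
  ring

theorem norm_le_one_of_mem_simplex {d : ℕ} {η : Vec d} (h : η ∈ simplex d) : ‖η‖ ≤ 1 := by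
  refine (norm_le_sum_abs _).trans ?_
  rw [← h.2]
  exact (Finset.sum_congr rfl fun i _ => abs_of_nonneg (h.1 i)).le

theorem basisVec_mem_simplex {d : ℕ} (x : Fin d) : basisVec x ∈ simplex d := by
  refine ⟨fun y => ?_, ?_⟩
  · by_cases h : y = x <;> simp [basisVec, h]
  · simp [basisVec]

theorem convex_simplex (d : ℕ) : Convex ℝ (simplex d) := by
  intro η hη η' hη' a b ha hb hab
  refine ⟨fun x => ?_, ?_⟩
  · simp only [PiLp.add_apply, PiLp.smul_apply, smul_eq_mul]
    exact add_nonneg (mul_nonneg ha (hη.1 x)) (mul_nonneg hb (hη'.1 x))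
  · simp only [PiLp.add_apply, PiLp.smul_apply, smul_eq_mul, Finset.sum_add_distrib,
      ← Finset.mul_sum, hη.2, hη'.2]
    linarith

theorem isCompact_simplex (d : ℕ) : IsCompact (simplex d) := by
  refine Metric.isCompact_of_isClosed_isBounded ?_ ?_
  · have h1 : IsClosed {η : Vec d | ∀ x, 0 ≤ η x} := by
      simp only [ofPred_forall]
      exact isClosed_iInter fun x => isClosed_le continuous_const (by fun_prop)
    have h2 : IsClosed {η : Vec d | ∑ x, η x = 1} :=
      isClosed_eq (by fun_prop) continuous_const
    exact h1.inter h2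
  · refine Metric.isBounded_closedBall (x := (0 : Vec d)) (r := 1) |>.subset fun η hη => ?_
    simpa using norm_le_one_of_mem_simplex hη

/-- Makes the Hamilton-Jacobi-Bellman equation a finite system of ordinary differential equations,
as the barrier argument requires. -/
theorem lattice_finite (d : ℕ) {m : ℕ} (hm : 0 < m) : (lattice d m).Finite := by
  have hfin : {k : Fin d → ℕ | k ≤ fun _ => m}.Finite := Set.finite_Iic _
  refine (hfin.image fun k : Fin d → ℕ => (WithLp.toLp 2 fun x => (k x : ℝ) / m : Vec d)).subset ?_
  rintro η ⟨hη, hk⟩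
  choose k hk using hk
  have hm' : (0 : ℝ) < m := by exact_mod_cast hm
  refine ⟨k, fun x => ?_, ?_⟩
  · have h1 : η x ≤ 1 := by
      rw [← hη.2]
      exact Finset.single_le_sum (fun i _ => hη.1 i) (Finset.mem_univ x)
    have h2 : (k x : ℝ) ≤ m := by
      rw [← hk x]
      nlinarith
    exact_mod_cast h2
  · ext x
    simp only
    rw [← hk x]
    field_simp

/-- An occupied state carries at least one unit of mass `1 / m`, which may be moved to another state
without making an entry negative. -/
theorem add_moveVec_mem_lattice {d m : ℕ} (hm : 0 < m) {η : Vec d} (hη : η ∈ lattice d m)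
    {y : Fin d} (hy : η y ≠ 0) (z : Fin d) : η + (1 / (m : ℝ)) • moveVec y z ∈ lattice d m := by
  rcases eq_or_ne y z with rfl | hyz
  · simpa [moveVec_self] using hη
  have hm' : (0 : ℝ) < m := by exact_mod_cast hm
  obtain ⟨⟨hpos, hsum⟩, hk⟩ := hη
  have hcoord : ∀ w, ∃ k : ℕ, (m : ℝ) * (η + (1 / (m : ℝ)) • moveVec y z) w = k := by
    intro w
    obtain ⟨k, hk⟩ := hk w
    have hexp : (m : ℝ) * (η + (1 / (m : ℝ)) • moveVec y z) w = k + moveVec y z w := by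
      simp only [PiLp.add_apply, PiLp.smul_apply, smul_eq_mul]
      rw [mul_add, hk]
      field_simp
    rw [hexp, moveVec_apply]
    by_cases hwz : w = z
    · subst hwz
      exact ⟨k + 1, by simp [hyz.symm]⟩
    · by_cases hwy : w = y
      · subst hwy
        have hk0 : k ≠ 0 := by
          rintro rfl
          simp [hm'.ne', hy] at hk
        obtain ⟨j, rfl⟩ := Nat.exists_eq_succ_of_ne_zero hk0
        exact ⟨j, by simp [hyz]⟩
      · exact ⟨k, by simp [hwz, hwy]⟩
  refine ⟨⟨fun w => ?_, ?_⟩, hcoord⟩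
  · obtain ⟨k, hk⟩ := hcoord w
    have : 0 ≤ (m : ℝ) * (η + (1 / (m : ℝ)) • moveVec y z) w := by
      rw [hk]; positivity
    exact nonneg_of_mul_nonneg_right this hm'
  · simp only [PiLp.add_apply, PiLp.smul_apply, smul_eq_mul, Finset.sum_add_distrib,
      ← Finset.mul_sum, hsum, moveVec_apply, Finset.sum_sub_distrib]
    simp

theorem othersMeasure_mem_lattice {n d : ℕ} (hn : 2 ≤ n) (c : Fin n → Fin d) (i : Fin n) :
    othersMeasure c i ∈ lattice d (n - 1) := by
  have hN : (((n - 1 : ℕ)) : ℝ) = (n : ℝ) - 1 := by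
    rw [Nat.cast_sub (by omega)]; simp
  have hN0 : (0 : ℝ) < (n : ℝ) - 1 := by
    have : (2 : ℝ) ≤ n := by exact_mod_cast hn
    linarith
  have hcoord : ∀ w, othersMeasure c i w = (1 / ((n : ℝ) - 1)) *
      ((Finset.univ.erase i).filter fun j => w = c j).card := by
    intro w
    simp only [othersMeasure, PiLp.smul_apply, WithLp.ofLp_sum, Finset.sum_apply, smul_eq_mul,
      basisVec, PiLp.single_apply, Finset.sum_boole]
  refine ⟨⟨fun w => ?_, ?_⟩, fun w => ?_⟩
  · rw [hcoord]; positivity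
  · have h1 : ∀ w, othersMeasure c i w = (1 / ((n : ℝ) - 1)) *
        ∑ j ∈ Finset.univ.erase i, if w = c j then (1 : ℝ) else 0 := by
      intro w
      rw [hcoord, Finset.sum_boole]
    simp only [h1, ← Finset.mul_sum]
    rw [Finset.sum_comm]
    simp only [Finset.sum_ite_eq', Finset.mem_univ, if_true, Finset.sum_const,
      Finset.card_erase_of_mem, Finset.card_univ, Fintype.card_fin, nsmul_eq_mul, mul_one, hN]
    field_simp
  · rw [hcoord, hN]
    exact ⟨((Finset.univ.erase i).filter fun j => w = c j).card, by field_simp⟩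

/-! ### Uniform estimates near the solution of the master equation -/

/-- Uniform estimates that hold as long as the values of a competitor are within `δ` of those
of `U`. -/
structure UniformBounds {d : ℕ} (T : ℝ) (f : Fin d → Vec d → Vec d → ℝ)
    (astar : Fin d → Vec d → Vec d → Vec d) (U : ℝ → Fin d → Vec d → ℝ)
    (gradU : ℝ → Fin d → Vec d → Vec d) (δ L : ℝ) : Prop where
  delta_pos : 0 < δ
  const_nonneg : 0 ≤ L
  lipschitz : ∀ t ∈ Icc 0 T, ∀ x, ∀ η ∈ simplex d, ∀ η' ∈ simplex d,
    |U t x η' - U t x η| ≤ L * ‖η' - η‖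
  taylor : ∀ t ∈ Icc 0 T, ∀ x, ∀ η ∈ simplex d, ∀ η' ∈ simplex d,
    |U t x η' - U t x η - inner ℝ (gradU t x η) (η' - η)| ≤ L * ‖η' - η‖ ^ 2
  astar_close : ∀ t ∈ Icc 0 T, ∀ x, ∀ η ∈ simplex d, ∀ η' ∈ simplex d, ∀ φ : Fin d → ℝ,
    ∀ ε ≤ δ, (∀ l, |φ l - U t l η'| ≤ ε) →
      ‖astar x η' (increments x φ) - astar x η (increments x fun l => U t l η)‖
        ≤ L * (‖η' - η‖ + ε)
  hamiltonian_close : ∀ t ∈ Icc 0 T, ∀ x, ∀ η ∈ simplex d, ∀ φ : Fin d → ℝ,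
    ∀ ε ≤ δ, (∀ l, |φ l - U t l η| ≤ ε) →
      |hamiltonian f x η (increments x φ) - hamiltonian f x η (increments x fun l => U t l η)|
        ≤ L * ε
  astar_bound : ∀ t ∈ Icc 0 T, ∀ x, ∀ η ∈ simplex d,
    ‖astar x η (increments x fun l => U t l η)‖ ≤ L

/-- Continuity on a compact set bounds the values of `U`, so that the supremum defining `supAbs` is
a genuine one. -/
theorem SolvesMaster.abs_le_supAbs {d : ℕ} {T : ℝ} {f : Fin d → Vec d → Vec d → ℝ}
    {g : Fin d → Vec d → ℝ} {astar : Fin d → Vec d → Vec d → Vec d} {U : ℝ → Fin d → Vec d → ℝ}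
    {gradU : ℝ → Fin d → Vec d → Vec d} (h : SolvesMaster T f g astar U gradU) :
    ∀ t ∈ Icc 0 T, ∀ x, ∀ η ∈ simplex d, |U t x η| ≤ supAbs T U := by
  have hb : ∀ x, ∃ c : ℝ, ∀ q ∈ Icc 0 T ×ˢ simplex d, ‖U q.1 x q.2‖ ≤ c := fun x =>
    (isCompact_Icc.prod (isCompact_simplex d)).exists_bound_of_continuousOn (h.continuousOn x)
  choose c hc using hb
  intro t ht x η hη
  refine le_csSup ⟨∑ y, |c y|, ?_⟩ ⟨t, ht, x, η, hη, rfl⟩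
  rintro _ ⟨s, hs, y, θ, hθ, rfl⟩
  refine (hc y (s, θ) ⟨hs, hθ⟩).trans ((le_abs_self _).trans ?_)
  exact Finset.single_le_sum (f := fun y => |c y|) (fun i _ => abs_nonneg _) (Finset.mem_univ y)

theorem SolvesMaster.abs_sub_le {d : ℕ} {T : ℝ} {f : Fin d → Vec d → Vec d → ℝ}
    {g : Fin d → Vec d → ℝ} {astar : Fin d → Vec d → Vec d → Vec d} {U : ℝ → Fin d → Vec d → ℝ}
    {gradU : ℝ → Fin d → Vec d → Vec d} (h : SolvesMaster T f g astar U gradU) {c : ℝ}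
    (hc : ∀ t ∈ Icc 0 T, ∀ x, ∀ η ∈ simplex d, ‖gradU t x η‖ ≤ c) :
    ∀ t ∈ Icc 0 T, ∀ x, ∀ η ∈ simplex d, ∀ η' ∈ simplex d,
      |U t x η' - U t x η| ≤ c * ‖η' - η‖ := by
  intro t ht x η hη η' hη'
  refine (convex_simplex d).norm_image_sub_le_of_norm_hasFDerivWithin_le
    (f' := fun η => InnerProductSpace.toDual ℝ (Vec d) (gradU t x η))
    (fun θ hθ => h.gradient t ht x θ hθ) (fun θ hθ => ?_) hη hη'
  rw [LinearIsometryEquiv.norm_map]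
  exact hc t ht x θ hθ

/-- The mean value inequality on the segment from `η` to `η'`, for `U` minus its linearization at
`η`: along the segment the gradient deviates from `gradU t x η` by at most `c * ‖η' - η‖`. -/
theorem SolvesMaster.abs_sub_sub_inner_le {d : ℕ} {T : ℝ} {f : Fin d → Vec d → Vec d → ℝ}
    {g : Fin d → Vec d → ℝ} {astar : Fin d → Vec d → Vec d → Vec d} {U : ℝ → Fin d → Vec d → ℝ}
    {gradU : ℝ → Fin d → Vec d → Vec d} (h : SolvesMaster T f g astar U gradU) {c : ℝ}
    (hc0 : 0 ≤ c) (hc : ∀ t ∈ Icc 0 T, ∀ x, ∀ η ∈ simplex d, ∀ η' ∈ simplex d,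
      ‖gradU t x η - gradU t x η'‖ ≤ c * ‖η - η'‖) :
    ∀ t ∈ Icc 0 T, ∀ x, ∀ η ∈ simplex d, ∀ η' ∈ simplex d,
      |U t x η' - U t x η - inner ℝ (gradU t x η) (η' - η)| ≤ c * ‖η' - η‖ ^ 2 := by
  intro t ht x η hη η' hη'
  have hsub : segment ℝ η η' ⊆ simplex d := (convex_simplex d).segment_subset hη hη'
  have := (convex_segment η η').norm_image_sub_le_of_norm_hasFDerivWithin_le'
    (f := U t x) (f' := fun η => InnerProductSpace.toDual ℝ (Vec d) (gradU t x η))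
    (φ := InnerProductSpace.toDual ℝ (Vec d) (gradU t x η)) (C := c * ‖η' - η‖)
    (fun θ hθ => (h.gradient t ht x θ (hsub hθ)).hasFDerivWithinAt.mono hsub) (fun θ hθ => ?_)
    (left_mem_segment ℝ η η') (right_mem_segment ℝ η η')
  · rw [Real.norm_eq_abs, InnerProductSpace.toDual_apply_apply] at this
    refine this.trans (le_of_eq ?_)
    ring
  · rw [← map_sub, LinearIsometryEquiv.norm_map]
    refine (hc t ht x θ (hsub hθ) η hη).trans (mul_le_mul_of_nonneg_left ?_ hc0)
    obtain ⟨a, b, ha, hb, hab, rfl⟩ := hθ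
    have : a • η + b • η' - η = b • (η' - η) := by
      have ha' : a = 1 - b := by linarith
      rw [ha']; module
    rw [this, norm_smul, Real.norm_of_nonneg hb]
    exact mul_le_of_le_one_left (norm_nonneg _) (by linarith)

theorem RegularityAssumption.exists_uniformBounds {d : ℕ} {T : ℝ}
    {f : Fin d → Vec d → Vec d → ℝ} {g : Fin d → Vec d → ℝ}
    {astar : Fin d → Vec d → Vec d → Vec d} {V : ℕ → ℝ → Fin d → Vec d → ℝ}
    {U : ℝ → Fin d → Vec d → ℝ} {gradU : ℝ → Fin d → Vec d → Vec d}
    (h : RegularityAssumption T f g astar V U gradU) :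
    ∃ δ L, UniformBounds T f astar U gradU δ L := by
  obtain ⟨c₁, hc₁⟩ := h.gradient_bounded
  obtain ⟨c₂, hc₂⟩ := h.gradient_lipschitz
  obtain ⟨K, hK, ⟨c₃, hc₃⟩, -, ⟨c₄, hc₄⟩⟩ := h.local_regularity
  have hsup : 0 ≤ supAbs T U := Real.sSup_nonneg (by
    rintro _ ⟨t, _, x, η, _, rfl⟩
    exact abs_nonneg _)
  have hK0 : 0 ≤ K := by linarith
  -- Values within `δ` of those of `U` have increments of size at most `2 * supAbs T U + 2 * δ = K`,
  -- hence inside the cube where the Lipschitz assumptions apply.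
  set δ := (K - 2 * supAbs T U) / 2 with hδ
  have hδ0 : 0 < δ := by rw [hδ]; linarith
  have habs := h.master.abs_le_supAbs
  have hcube : ∀ t ∈ Icc 0 T, ∀ x, ∀ η ∈ simplex d, ∀ φ : Fin d → ℝ,
      (∀ l, |φ l - U t l η| ≤ δ) → increments x φ ∈ cube d K := by
    intro t ht x η hη φ hφ l
    change |φ l - φ x| ≤ K
    have h1 := abs_le.1 (hφ l)
    have h2 := abs_le.1 (hφ x)
    have h3 := abs_le.1 (habs t ht l η hη)
    have h4 := abs_le.1 (habs t ht x η hη)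
    have h5 : K = 2 * supAbs T U + 2 * δ := by rw [hδ]; ring
    rw [abs_le]
    constructor <;> linarith
  have hcubeU : ∀ t ∈ Icc 0 T, ∀ x, ∀ η ∈ simplex d,
      (increments x fun l => U t l η) ∈ cube d K := fun t ht x η hη =>
    hcube t ht x η hη _ fun l => by simpa using hδ0.le
  have hc₂' : ∀ t ∈ Icc 0 T, ∀ x, ∀ η ∈ simplex d, ∀ η' ∈ simplex d,
      ‖gradU t x η - gradU t x η'‖ ≤ |c₂| * ‖η - η'‖ := fun t ht x η hη η' hη' =>
    (hc₂ t ht x η hη η' hη').trans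
      (mul_le_mul_of_nonneg_right (le_abs_self _) (norm_nonneg _))
  have hlip := h.master.abs_sub_le (c := |c₁|)
    fun t ht x η hη => (hc₁ t ht x η hη).trans (le_abs_self _)
  have htay := h.master.abs_sub_sub_inner_le (abs_nonneg c₂) hc₂'
  set D : ℝ := 2 * d with hD
  have hD0 : 0 ≤ D := by positivity
  -- Reference values of `astar` at one point per state, with `p = 0`. The Lipschitz estimate
  -- carries this bound to the whole simplex.
  set R : ℝ := ∑ x, ‖astar x (basisVec x) 0‖ with hR
  have hR0 : 0 ≤ R := Finset.sum_nonneg fun x _ => norm_nonneg _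
  set L₁ := |c₃| * (1 + D + D * |c₁|) with hL₁
  set L₂ := |c₄| * D with hL₂
  set L₃ := |c₃| * (2 + d * K) + R with hL₃
  have hL₁0 : 0 ≤ L₁ := by positivity
  have hL₂0 : 0 ≤ L₂ := by positivity
  have hL₃0 : 0 ≤ L₃ := by positivity
  have hinc : ∀ x (φ φ' : Fin d → ℝ) (r : ℝ), (∀ l, |φ l - φ' l| ≤ r) →
      ‖increments x φ - increments x φ'‖ ≤ D * r := by
    intro x φ φ' r hr
    rw [increments_sub]
    refine (norm_increments_le x hr).trans (le_of_eq ?_)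
    rw [hD]; ring
  refine ⟨δ, |c₁| + |c₂| + L₁ + L₂ + L₃, hδ0, by positivity, ?_, ?_, ?_, ?_, ?_⟩
  · intro t ht x η hη η' hη'
    refine (hlip t ht x η hη η' hη').trans (mul_le_mul_of_nonneg_right ?_ (norm_nonneg _))
    linarith [abs_nonneg c₂]
  · intro t ht x η hη η' hη'
    refine (htay t ht x η hη η' hη').trans (mul_le_mul_of_nonneg_right ?_ (by positivity))
    linarith [abs_nonneg c₁]
  · intro t ht x η hη η' hη' φ ε hε hφ
    have hε0 : 0 ≤ ε := (abs_nonneg _).trans (hφ x)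
    have h1 := hc₃ x η' hη' η hη _ (hcube t ht x η' hη' φ fun l => (hφ l).trans hε) _
      (hcubeU t ht x η hη)
    have h2 := hinc x φ (fun l => U t l η) (ε + |c₁| * ‖η' - η‖) fun l => show |φ l - U t l η| ≤ _ by
      calc |φ l - U t l η| ≤ |φ l - U t l η'| + |U t l η' - U t l η| := abs_sub_le _ _ _
        _ ≤ ε + |c₁| * ‖η' - η‖ := add_le_add (hφ l) (hlip t ht l η hη η' hη')
    set r := ‖η' - η‖ with hr
    have hr0 : 0 ≤ r := norm_nonneg _
    calc _ ≤ c₃ * (r + ‖increments x φ - increments x fun l => U t l η‖) := h1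
      _ ≤ |c₃| * (r + ‖increments x φ - increments x fun l => U t l η‖) :=
        mul_le_mul_of_nonneg_right (le_abs_self _) (by positivity)
      _ ≤ |c₃| * (r + D * (ε + |c₁| * r)) :=
        mul_le_mul_of_nonneg_left (by linarith) (abs_nonneg _)
      _ ≤ L₁ * (r + ε) := by
        have h3 : 0 ≤ D * r := by positivity
        have h4 : 0 ≤ D * |c₁| * ε := by positivity
        have h5 : r + D * (ε + |c₁| * r) ≤ (1 + D + D * |c₁|) * (r + ε) := by linarith
        refine (mul_le_mul_of_nonneg_left h5 (abs_nonneg c₃)).trans (le_of_eq ?_)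
        rw [hL₁]; ring
      _ ≤ _ := mul_le_mul_of_nonneg_right (by linarith [abs_nonneg c₁, abs_nonneg c₂])
        (by positivity)
  · intro t ht x η hη φ ε hε hφ
    have hε0 : 0 ≤ ε := (abs_nonneg _).trans (hφ x)
    have h1 := hc₄ x η hη _ (hcube t ht x η hη φ fun l => (hφ l).trans hε) _ (hcubeU t ht x η hη)
    have h2 := hinc x φ (fun l => U t l η) ε hφ
    calc _ ≤ c₄ * ‖increments x φ - increments x fun l => U t l η‖ := h1
      _ ≤ |c₄| * (D * ε) := mul_le_mul (le_abs_self _) h2 (norm_nonneg _) (abs_nonneg _)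
      _ = L₂ * ε := by rw [hL₂]; ring
      _ ≤ _ := mul_le_mul_of_nonneg_right (by linarith [abs_nonneg c₁, abs_nonneg c₂]) hε0
  · intro t ht x η hη
    set p := increments x fun l => U t l η with hp
    have hpc : p ∈ cube d K := hcubeU t ht x η hη
    have h0c : (0 : Vec d) ∈ cube d K := fun y => by simpa using hK0
    have h1 := hc₃ x η hη _ (basisVec_mem_simplex x) p hpc 0 h0c
    have h2 : ‖p - 0‖ ≤ d * K := by
      rw [sub_zero]
      refine (norm_le_sum_abs _).trans ?_
      calc ∑ i, |p i| ≤ ∑ _i : Fin d, K := Finset.sum_le_sum fun i _ => hpc i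
        _ = d * K := by simp
    have h3 : ‖η - basisVec x‖ ≤ 2 := (norm_sub_le _ _).trans (by
      rw [norm_basisVec]; linarith [norm_le_one_of_mem_simplex hη])
    have h4 : ‖astar x (basisVec x) 0‖ ≤ R :=
      Finset.single_le_sum (f := fun x => ‖astar x (basisVec x) 0‖) (fun i _ => norm_nonneg _)
        (Finset.mem_univ x)
    have h5 : ‖astar x η p - astar x (basisVec x) 0‖ ≤ |c₃| * (2 + d * K) :=
      h1.trans (mul_le_mul (le_abs_self _) (add_le_add h3 h2) (by positivity) (abs_nonneg _))
    calc ‖astar x η p‖ = ‖(astar x η p - astar x (basisVec x) 0) + astar x (basisVec x) 0‖ := by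
          rw [sub_add_cancel]
      _ ≤ L₃ := (norm_add_le _ _).trans (add_le_add h5 h4)
      _ ≤ _ := by linarith [abs_nonneg c₁, abs_nonneg c₂]

theorem abs_apply_le_norm {d : ℕ} (v : Vec d) (i : Fin d) : |v i| ≤ ‖v‖ :=
  PiLp.norm_apply_le v i

theorem cast_sub_one_eq {n : ℕ} (hn : 2 ≤ n) : (((n - 1 : ℕ)) : ℝ) = (n : ℝ) - 1 := by
  rw [Nat.cast_sub (by omega)]; simp

theorem cast_sub_one_pos {n : ℕ} (hn : 2 ≤ n) : (0 : ℝ) < (n : ℝ) - 1 := by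
  have : (2 : ℝ) ≤ n := by exact_mod_cast hn
  linarith

theorem sum_eq_zero_of_mem_rateVecs {d : ℕ} {x : Fin d} {a : Vec d} (h : a ∈ rateVecs x) :
    ∑ z, a z = 0 := by
  rw [← Finset.add_sum_erase _ _ (Finset.mem_univ x), h.2]
  ring

/-! ### Maximum principle for the distance of the value functions -/

/-- At a point where the distance of a competitor to `U` is maximal, the right-hand side of the
Hamilton-Jacobi-Bellman system exceeds that of the master equation only by the size of the distance
and of the discretization error. -/
theorem UniformBounds.drift_sub_le {d : ℕ} {T : ℝ} {f : Fin d → Vec d → Vec d → ℝ}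
    {astar : Fin d → Vec d → Vec d → Vec d} {U : ℝ → Fin d → Vec d → ℝ}
    {gradU : ℝ → Fin d → Vec d → Vec d} {δ L : ℝ} (h : UniformBounds T f astar U gradU δ L)
    (hastar : IsUniqueMinimizer f astar) {n : ℕ} (hn : 2 ≤ n) {t : ℝ} (ht : t ∈ Icc 0 T)
    (v : Fin d → Vec d → ℝ) {ε : ℝ} (hε : ε ≤ δ)
    (hv : ∀ l, ∀ θ ∈ lattice d (n - 1), |v l θ - U t l θ| ≤ ε) {s : ℝ} (hs : |s| = 1)
    (x : Fin d) {η : Vec d} (hη : η ∈ lattice d (n - 1)) (hmax : s * (v x η - U t x η) = ε) :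
    s * ((∑ y, ∑ z, η y * diffQuot n y z (v x) η *
            astar y (η + (1 / ((n : ℝ) - 1)) • moveVec y x)
              (increments y fun l => v l (η + (1 / ((n : ℝ) - 1)) • moveVec y x)) z)
          + hamiltonian f x η (increments x fun l => v l η)
        - ((∑ y, ∑ z, gradU t x η z * η y * astar y η (increments y fun l => U t l η) z)
          + hamiltonian f x η (increments x fun l => U t l η)))
      ≤ (d * (8 * L ^ 2) + L) * (ε + 1 / ((n : ℝ) - 1)) := by
  have hN := cast_sub_one_pos hn
  have hm : 0 < n - 1 := by omega
  have hshift : ∀ {y}, η y ≠ 0 → ∀ z, η + (1 / ((n : ℝ) - 1)) • moveVec y z ∈ lattice d (n - 1) := by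
    intro y hy z
    have := add_moveVec_mem_lattice hm hη hy z
    rwa [cast_sub_one_eq hn] at this
  set N : ℝ := (n : ℝ) - 1 with hNdef
  have hL := h.const_nonneg
  have hε0 : 0 ≤ ε := (abs_nonneg _).trans (hv x η hη)
  have hstep : ∀ y z, ‖(η + (1 / N) • moveVec y z) - η‖ ≤ 2 / N := by
    intro y z
    rw [add_sub_cancel_left, norm_smul, Real.norm_of_nonneg (by positivity), div_mul_eq_mul_div,
      one_mul]
    exact div_le_div_of_nonneg_right (norm_moveVec_le y z) hN.le
  have hyz : ∀ y, η y ≠ 0 → ∀ z,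
      s * (diffQuot n y z (v x) η * astar y (η + (1 / N) • moveVec y x)
              (increments y fun l => v l (η + (1 / N) • moveVec y x)) z
        - (gradU t x η z - gradU t x η y) * astar y η (increments y fun l => U t l η) z)
      ≤ 8 * L ^ 2 * (ε + 1 / N) := by
    intro y hy z
    have hη' := hshift hy x
    have hη'' := hshift hy z
    set η' := η + (1 / N) • moveVec y x with hη'def
    set a₁ := astar y η' (increments y fun l => v l η') with ha₁
    set a₀ := astar y η (increments y fun l => U t l η) with ha₀
    set DU := diffQuot n y z (U t x) η with hDU
    -- The maximum principle: `s * (v - U)` attains its bound `ε` at `η`, so its difference quotient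
    -- is nonpositive, and `a₁ z ≥ 0` for `z ≠ y`. The negative diagonal rate is harmless because
    -- the quotient vanishes for `z = y`.
    have h1 : s * (diffQuot n y z (v x) η * a₁ z) ≤ s * (DU * a₁ z) := by
      rcases eq_or_ne z y with rfl | hzy
      · simp [hDU, diffQuot, moveVec_self]
      · have ha : 0 ≤ a₁ z := (hastar.mem y η' hη'.1 _).1 z hzy
        have h2 : s * (v x (η + (1 / N) • moveVec y z) - U t x (η + (1 / N) • moveVec y z)) ≤ ε := by
          refine (le_abs_self _).trans ?_
          rw [abs_mul, hs, one_mul]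
          exact hv x _ hη''
        have h3 : s * diffQuot n y z (v x) η - s * DU = N *
            (s * (v x (η + (1 / N) • moveVec y z) - U t x (η + (1 / N) • moveVec y z))
              - s * (v x η - U t x η)) := by
          rw [hDU, diffQuot, diffQuot]; ring
        have h4 : s * diffQuot n y z (v x) η - s * DU ≤ 0 := by
          rw [h3, hmax]
          exact mul_nonpos_of_nonneg_of_nonpos hN.le (by linarith)
        have h5 := mul_nonpos_of_nonpos_of_nonneg h4 ha
        linarith
    have hDUb : |DU| ≤ 2 * L := by
      rw [hDU, diffQuot, abs_mul, abs_of_pos hN]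
      have h2 := (h.lipschitz t ht x η hη.1 _ hη''.1).trans
        (mul_le_mul_of_nonneg_left (hstep y z) hL)
      calc N * |U t x (η + (1 / N) • moveVec y z) - U t x η| ≤ N * (L * (2 / N)) :=
            mul_le_mul_of_nonneg_left h2 hN.le
        _ = 2 * L := by field_simp
    have hDUG : |DU - (gradU t x η z - gradU t x η y)| ≤ 4 * L * (1 / N) := by
      have h2 := h.taylor t ht x η hη.1 _ hη''.1
      have h3 : ‖(η + (1 / N) • moveVec y z) - η‖ ^ 2 ≤ (2 / N) ^ 2 :=
        pow_le_pow_left₀ (norm_nonneg _) (hstep y z) 2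
      have h4 : DU - (gradU t x η z - gradU t x η y) = N *
          (U t x (η + (1 / N) • moveVec y z) - U t x η
            - inner ℝ (gradU t x η) (η + (1 / N) • moveVec y z - η)) := by
        rw [add_sub_cancel_left, inner_smul_right, inner_moveVec, hDU, diffQuot, ← hNdef]
        field_simp
      rw [h4, abs_mul, abs_of_pos hN]
      calc _ ≤ N * (L * (2 / N) ^ 2) :=
            mul_le_mul_of_nonneg_left (h2.trans (mul_le_mul_of_nonneg_left h3 hL)) hN.le
        _ = 4 * L * (1 / N) := by field_simp; norm_num
    have ha₁₀ : |a₁ z - a₀ z| ≤ L * (2 * (1 / N) + ε) := by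
      have h2 := h.astar_close t ht y η hη.1 η' hη'.1 (fun l => v l η') ε hε
        fun l => hv l η' hη'
      have h3 := abs_apply_le_norm (a₁ - a₀) z
      rw [PiLp.sub_apply] at h3
      refine h3.trans (h2.trans (mul_le_mul_of_nonneg_left ?_ hL))
      have := hstep y x
      rw [mul_one_div]
      linarith
    have ha₀b : |a₀ z| ≤ L := (abs_apply_le_norm a₀ z).trans (h.astar_bound t ht y η hη.1)
    have h6 : s * (DU * a₁ z - (gradU t x η z - gradU t x η y) * a₀ z)
        ≤ 2 * L * (L * (2 * (1 / N) + ε)) + 4 * L * (1 / N) * L := by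
      refine (le_abs_self _).trans ?_
      rw [abs_mul, hs, one_mul]
      have : DU * a₁ z - (gradU t x η z - gradU t x η y) * a₀ z
          = DU * (a₁ z - a₀ z) + (DU - (gradU t x η z - gradU t x η y)) * a₀ z := by ring
      rw [this]
      refine (abs_add_le _ _).trans (add_le_add ?_ ?_)
      · rw [abs_mul]
        exact mul_le_mul hDUb ha₁₀ (abs_nonneg _) (by positivity)
      · rw [abs_mul]
        exact mul_le_mul hDUG ha₀b (abs_nonneg _) (by positivity)
    have h7 : 0 ≤ L ^ 2 * ε := by positivity
    have h8 : s * (diffQuot n y z (v x) η * a₁ z - (gradU t x η z - gradU t x η y) * a₀ z)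
      ≤ s * (DU * a₁ z - (gradU t x η z - gradU t x η y) * a₀ z) := by linarith
    refine (h8.trans h6).trans ?_
    have h9 : 2 * L * (L * (2 * (1 / N) + ε)) + 4 * L * (1 / N) * L
      = 8 * L ^ 2 * (1 / N) + 2 * (L ^ 2 * ε) := by ring
    rw [h9]
    linarith
  have hy : ∀ y, s * ((∑ z, η y * diffQuot n y z (v x) η * astar y (η + (1 / N) • moveVec y x)
              (increments y fun l => v l (η + (1 / N) • moveVec y x)) z)
        - ∑ z, gradU t x η z * η y * astar y η (increments y fun l => U t l η) z)
      ≤ η y * (d * (8 * L ^ 2 * (ε + 1 / N))) := by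
    intro y
    by_cases hy : η y = 0
    · simp [hy]
    -- Since the rates sum to zero, `gradU z` may be replaced by `gradU z - gradU y`, the derivative
    -- along `moveVec y z`, which is what the quotients of `U` approximate.
    have h0 := sum_eq_zero_of_mem_rateVecs (hastar.mem y η hη.1 (increments y fun l => U t l η))
    have h1 : (∑ z, η y * diffQuot n y z (v x) η * astar y (η + (1 / N) • moveVec y x)
              (increments y fun l => v l (η + (1 / N) • moveVec y x)) z)
        - ∑ z, gradU t x η z * η y * astar y η (increments y fun l => U t l η) z
        = η y * ∑ z, (diffQuot n y z (v x) η * astar y (η + (1 / N) • moveVec y x)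
              (increments y fun l => v l (η + (1 / N) • moveVec y x)) z
        - (gradU t x η z - gradU t x η y) * astar y η (increments y fun l => U t l η) z) := by
      simp only [sub_mul, Finset.sum_sub_distrib, ← Finset.mul_sum, h0, mul_zero, sub_zero]
      rw [mul_sub, Finset.mul_sum, Finset.mul_sum]
      congr 1
      · exact Finset.sum_congr rfl fun z _ => by ring
      · exact Finset.sum_congr rfl fun z _ => by ring
    rw [h1, mul_left_comm]
    refine mul_le_mul_of_nonneg_left ?_ (hη.1.1 y)
    rw [Finset.mul_sum]
    refine (Finset.sum_le_sum fun z _ => hyz y hy z).trans (le_of_eq ?_)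
    simp
  have hsum : s * ((∑ y, ∑ z, η y * diffQuot n y z (v x) η *
            astar y (η + (1 / N) • moveVec y x)
              (increments y fun l => v l (η + (1 / N) • moveVec y x)) z)
        - ∑ y, ∑ z, gradU t x η z * η y * astar y η (increments y fun l => U t l η) z)
      ≤ d * (8 * L ^ 2 * (ε + 1 / N)) := by
    rw [← Finset.sum_sub_distrib, Finset.mul_sum]
    refine (Finset.sum_le_sum fun y _ => hy y).trans (le_of_eq ?_)
    rw [← Finset.sum_mul, hη.1.2, one_mul]
  have hH : s * (hamiltonian f x η (increments x fun l => v l η)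
      - hamiltonian f x η (increments x fun l => U t l η)) ≤ L * ε := by
    refine (le_abs_self _).trans ?_
    rw [abs_mul, hs, one_mul]
    exact h.hamiltonian_close t ht x η hη.1 _ ε hε fun l => hv l η hη
  have hLN : 0 ≤ L * (1 / N) := by positivity
  linarith

/-- The value function of the `n`-player game differs from the solution of the master equation by
`O(1 / n)`. -/
theorem UniformBounds.exists_abs_value_sub_le {d : ℕ} {T : ℝ}
    {f : Fin d → Vec d → Vec d → ℝ} {g : Fin d → Vec d → ℝ}
    {astar : Fin d → Vec d → Vec d → Vec d} {V : ℕ → ℝ → Fin d → Vec d → ℝ}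
    {U : ℝ → Fin d → Vec d → ℝ} {gradU : ℝ → Fin d → Vec d → Vec d} {δ L : ℝ}
    (h : UniformBounds T f astar U gradU δ L) (hastar : IsUniqueMinimizer f astar)
    (hreg : RegularityAssumption T f g astar V U gradU) :
    ∃ n₀ : ℕ, ∃ C : ℝ, 0 ≤ C ∧ ∀ n, n₀ ≤ n → 2 ≤ n → C / ((n : ℝ) - 1) ≤ δ ∧
      ∀ t ∈ Icc 0 T, ∀ x, ∀ η ∈ lattice d (n - 1),
        |V n t x η - U t x η| ≤ C / ((n : ℝ) - 1) := by
  set A : ℝ := d * (8 * L ^ 2) + L with hA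
  have hL := h.const_nonneg
  have hA0 : 0 ≤ A := by positivity
  -- As `1 / N ≤ ψ`, the drift error `A * (ψ + 1 / N)` is at most `2 * A * ψ`. The extra `1` makes
  -- the decay `B * ψ` of the barrier strictly larger.
  set B : ℝ := 2 * A + 1 with hB
  have hB0 : 0 < B := by positivity
  -- This threshold keeps the barrier below `δ` on `[0, T]`. The extra `1` is there because the
  -- denominator is `n - 1`.
  refine ⟨⌈Real.exp (B * T) / δ⌉₊ + 1, Real.exp (B * T), (Real.exp_pos _).le, fun n hn₀ hn => ?_⟩
  have hN := cast_sub_one_pos hn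
  have hδN : Real.exp (B * T) / ((n : ℝ) - 1) ≤ δ := by
    rw [div_le_iff₀ hN, ← div_le_iff₀' h.delta_pos]
    refine (Nat.le_ceil _).trans ?_
    have : ((⌈Real.exp (B * T) / δ⌉₊ + 1 : ℕ) : ℝ) ≤ n := by exact_mod_cast hn₀
    push_cast at this
    linarith
  refine ⟨hδN, ?_⟩
  set N : ℝ := (n : ℝ) - 1 with hNdef
  have hfin := lattice_finite d (m := n - 1) (by omega)
  have := hfin.to_subtype
  set ψ : ℝ → ℝ := fun t => Real.exp (B * (T - t)) / N with hψ
  have hψle : ∀ t ∈ Icc 0 T, ψ t ≤ Real.exp (B * T) / N := fun t ht =>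
    div_le_div_of_nonneg_right (Real.exp_le_exp.2 (mul_le_mul_of_nonneg_left
      (by linarith [ht.1]) hB0.le)) hN.le
  have hψge : ∀ t ∈ Icc 0 T, 1 / N ≤ ψ t := fun t ht =>
    div_le_div_of_nonneg_right (Real.one_le_exp (mul_nonneg hB0.le (by linarith [ht.2]))) hN.le
  have hψpos : ∀ t, 0 < ψ t := fun t => by positivity
  -- Both signs are run through the barrier together, so that at a touching time the absolute value
  -- of every difference is controlled.
  let sgn : Bool → ℝ := fun b => if b then 1 else -1
  have hsgn : ∀ b, |sgn b| = 1 := by rintro (_ | _) <;> simp [sgn]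
  have hjb := hreg.hjb n hn
  have hma := hreg.master
  have key := lt_of_backward_barrier
    (ι := Bool × Fin d × lattice d (n - 1)) (T := T)
    (W := fun k t => sgn k.1 * (V n t k.2.1 k.2.2 - U t k.2.1 k.2.2))
    (W' := fun k t => sgn k.1 *
      ((-((∑ y, ∑ z, (k.2.2 : Vec d) y * diffQuot n y z (V n t k.2.1) k.2.2 *
            astar y ((k.2.2 : Vec d) + (1 / ((n : ℝ) - 1)) • moveVec y k.2.1)
              (increments y fun l =>
                V n t l ((k.2.2 : Vec d) + (1 / ((n : ℝ) - 1)) • moveVec y k.2.1)) z)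
          + hamiltonian f k.2.1 k.2.2 (increments k.2.1 fun l => V n t l k.2.2)))
      - (-((∑ y, ∑ z, gradU t k.2.1 k.2.2 z * (k.2.2 : Vec d) y *
            astar y k.2.2 (increments y fun l => U t l k.2.2) z)
          + hamiltonian f k.2.1 k.2.2 (increments k.2.1 fun l => U t l k.2.2)))))
    (ψ := ψ) (ψ' := fun t => -(B * ψ t)) ?_ ?_ ?_ ?_
  · intro t ht x η hη
    refine le_trans ?_ (hψle t ht)
    have h1 := key (true, x, ⟨η, hη⟩) t ht
    have h2 := key (false, x, ⟨η, hη⟩) t ht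
    simp only [sgn, if_true, one_mul, Bool.false_eq_true, if_false] at h1 h2
    rw [abs_le]
    constructor <;> linarith
  · rintro ⟨b, x, η, hη⟩ t ht
    exact ((hjb.deriv t ht x η hη).sub (hma.deriv t ht x η hη.1)).const_mul (sgn b)
  · intro t
    have h1 : HasDerivAt (fun t => B * (T - t)) (B * (-1)) t :=
      ((hasDerivAt_id t).const_sub T).const_mul B
    refine (h1.exp.div_const N).congr_deriv ?_
    rw [hψ]; ring
  · rintro ⟨b, x, η, hη⟩
    simp only
    rw [hjb.terminal x η hη, hma.terminal x η hη.1, sub_self, mul_zero]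
    exact hψpos T
  · rintro t ht hle ⟨b, x, η, hη⟩ heq
    have hclose : ∀ l, ∀ θ ∈ lattice d (n - 1), |V n t l θ - U t l θ| ≤ ψ t := by
      intro l θ hθ
      have h1 := hle (true, l, ⟨θ, hθ⟩)
      have h2 := hle (false, l, ⟨θ, hθ⟩)
      simp only [sgn, if_true, one_mul, Bool.false_eq_true, if_false] at h1 h2
      rw [abs_le]
      constructor <;> linarith
    have hd := h.drift_sub_le hastar hn ht (V n t) ((hψle t ht).trans hδN) hclose (hsgn b) x hη heq
    have h1 : A * (ψ t + 1 / N) ≤ 2 * A * ψ t := by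
      have := mul_le_mul_of_nonneg_left (hψge t ht) hA0
      linarith
    have h2 := hψpos t
    have h3 : B * ψ t = 2 * A * ψ t + ψ t := by rw [hB]; ring
    simp only
    linarith

/-! ### Bounded measurable rates -/

/-- Measurable and bounded on `[0, T]`. -/
def BddMeasurableOn (T : ℝ) (u : ℝ → ℝ) : Prop :=
  AEMeasurable u (volume.restrict (Icc 0 T)) ∧ ∃ b, ∀ t ∈ Icc 0 T, |u t| ≤ b

namespace BddMeasurableOn

variable {T : ℝ} {u v : ℝ → ℝ}

theorem const (T c : ℝ) : BddMeasurableOn T fun _ => c :=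
  ⟨aemeasurable_const, |c|, fun _ _ => le_rfl⟩

theorem add (hu : BddMeasurableOn T u) (hv : BddMeasurableOn T v) :
    BddMeasurableOn T fun t => u t + v t := by
  obtain ⟨hum, b, hb⟩ := hu
  obtain ⟨hvm, c, hc⟩ := hv
  exact ⟨hum.add hvm, b + c, fun t ht => (abs_add_le _ _).trans (add_le_add (hb t ht) (hc t ht))⟩

theorem mul (hu : BddMeasurableOn T u) (hv : BddMeasurableOn T v) :
    BddMeasurableOn T fun t => u t * v t := by
  obtain ⟨hum, b, hb⟩ := hu
  obtain ⟨hvm, c, hc⟩ := hv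
  refine ⟨hum.mul hvm, |b| * |c|, fun t ht => ?_⟩
  rw [abs_mul]
  exact mul_le_mul ((hb t ht).trans (le_abs_self _)) ((hc t ht).trans (le_abs_self _))
    (abs_nonneg _) (abs_nonneg _)

theorem sub (hu : BddMeasurableOn T u) (hv : BddMeasurableOn T v) :
    BddMeasurableOn T fun t => u t - v t := by
  simpa [sub_eq_add_neg] using hu.add ((const T (-1)).mul hv)

theorem min (hu : BddMeasurableOn T u) (hv : BddMeasurableOn T v) :
    BddMeasurableOn T fun t => min (u t) (v t) := by
  obtain ⟨hum, b, hb⟩ := hu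
  obtain ⟨hvm, c, hc⟩ := hv
  exact ⟨hum.min hvm, max b c, fun t ht => abs_min_le_max_abs_abs.trans
    (max_le_max (hb t ht) (hc t ht))⟩

theorem abs (hu : BddMeasurableOn T u) : BddMeasurableOn T fun t => |u t| := by
  obtain ⟨hum, b, hb⟩ := hu
  exact ⟨continuous_abs.measurable.comp_aemeasurable hum, b, fun t ht => by
    rw [abs_abs]; exact hb t ht⟩

theorem sum {ι : Type*} (s : Finset ι) {u : ι → ℝ → ℝ} (hu : ∀ i ∈ s, BddMeasurableOn T (u i)) :
    BddMeasurableOn T fun t => ∑ i ∈ s, u i t := by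
  classical
  induction s using Finset.induction_on with
  | empty => simpa using const T 0
  | insert a s ha ih =>
    simp only [Finset.sum_insert ha]
    exact (hu a (Finset.mem_insert_self a s)).add
      (ih fun i hi => hu i (Finset.mem_insert_of_mem hi))

end BddMeasurableOn

theorem IsUniqueMinimizer.preHamiltonian_le {d : ℕ} {f : Fin d → Vec d → Vec d → ℝ}
    {astar : Fin d → Vec d → Vec d → Vec d} (h : IsUniqueMinimizer f astar) (x : Fin d)
    {η : Vec d} (hη : η ∈ simplex d) (p : Vec d) {a : Vec d} (ha : a ∈ rateVecs x) :
    preHamiltonian f x η (astar x η p) p ≤ preHamiltonian f x η a p := by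
  by_cases haa : a = astar x η p
  · rw [haa]
  · exact (h.lt x η hη p a ha haa).le

/-- The minimizers are supergradients of the Hamiltonian, hence locally bounded in `p`. -/
theorem IsUniqueMinimizer.exists_le_of_abs_le {d : ℕ} {f : Fin d → Vec d → Vec d → ℝ}
    {astar : Fin d → Vec d → Vec d → Vec d} (h : IsUniqueMinimizer f astar) (x : Fin d)
    {η : Vec d} (hη : η ∈ simplex d) (R : ℝ) :
    ∃ b, 0 ≤ b ∧ ∀ p : Vec d, (∀ y, |p y| ≤ R) → ∀ z, max 0 (astar x η p z) ≤ b := by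
  -- Every `p` in the cube of radius `R` satisfies `p y - q y ≥ 1`, so passing from `q` to `p`
  -- raises the cost of `a` by at least its total rate. Comparison with the zero rates at `p` and
  -- with the minimizer at `q` bounds that total.
  set q : Vec d := WithLp.toLp 2 fun _ => -(R + 1) with hq
  set b := f x η 0 - preHamiltonian f x η (astar x η q) q with hb
  refine ⟨max 0 b, le_max_left _ _, fun p hp z => max_le_max le_rfl ?_ |>.trans
    (le_of_eq (max_eq_right (le_max_left 0 b)))⟩
  set a := astar x η p with ha
  have hmem : a ∈ rateVecs x := h.mem x η hη p
  have h0 : (0 : Vec d) ∈ rateVecs x := ⟨fun y _ => by simp, by simp⟩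
  have h1 := h.preHamiltonian_le x hη p h0
  have h2 := h.preHamiltonian_le x hη q hmem
  have h3 : preHamiltonian f x η 0 p = f x η 0 := by simp [preHamiltonian]
  rw [h3, ← ha] at h1
  have hpos : ∀ y ∈ Finset.univ.erase x, 0 ≤ a y := fun y hy => hmem.1 y (Finset.ne_of_mem_erase hy)
  have h4 : ∑ y ∈ Finset.univ.erase x, a y * q y + ∑ y ∈ Finset.univ.erase x, a y
      ≤ ∑ y ∈ Finset.univ.erase x, a y * p y := by
    rw [← Finset.sum_add_distrib]
    refine Finset.sum_le_sum fun y hy => ?_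
    have h5 := (abs_le.1 (hp y)).1
    have h6 := mul_le_mul_of_nonneg_left h5 (hpos y hy)
    have h7 : q y = -(R + 1) := rfl
    rw [h7]
    linarith
  have h5 : ∑ y ∈ Finset.univ.erase x, a y ≤ b := by
    simp only [preHamiltonian] at h1 h2 hb
    linarith
  by_cases hz : z = x
  · subst hz
    refine le_trans ?_ (le_max_left _ _)
    rw [hmem.2]
    linarith [Finset.sum_nonneg hpos]
  · refine le_trans ?_ (le_max_right _ _)
    exact (Finset.single_le_sum hpos (Finset.mem_erase.2 ⟨hz, Finset.mem_univ z⟩)).trans h5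

/-- The increments of `W` stay bounded over the compact time interval and minimizers are locally
bounded in `p`. No smallness of the increments is needed, so this covers `V n` also for small `n`,
where it is not known to be close to `U`. -/
theorem bddMeasurableOn_playerRate {n d : ℕ} (hn : 2 ≤ n) {T : ℝ}
    {f : Fin d → Vec d → Vec d → ℝ} {astar : Fin d → Vec d → Vec d → Vec d}
    (hastar : IsUniqueMinimizer f astar) {W : ℝ → Fin d → Vec d → ℝ}
    (hW : ∀ x, ∀ η ∈ lattice d (n - 1), ContinuousOn (fun t => W t x η) (Icc 0 T))
    (c : Fin n → Fin d) (i : Fin n) (z : Fin d) :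
    BddMeasurableOn T fun t => playerRate astar W t c i z := by
  have hη := othersMeasure_mem_lattice hn c i
  set η := othersMeasure c i with hηdef
  have hp : ContinuousOn (fun t => increments (c i) fun l => W t l η) (Icc 0 T) := by
    refine (PiLp.continuous_toLp 2 _).comp_continuousOn (continuousOn_pi.2 fun l => ?_)
    exact (hW l η hη).sub (hW (c i) η hη)
  refine ⟨?_, ?_⟩
  · have h1 : Measurable fun p : Vec d => astar (c i) η p :=
      (hastar.measurable (c i)).comp (measurable_const.prodMk measurable_id :
        Measurable fun p : Vec d => ((⟨η, hη.1⟩, p) : simplex d × Vec d))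
    have h2 : Measurable fun p : Vec d => max 0 (astar (c i) η p z) := by
      have : Measurable fun v : Vec d => v z := by fun_prop
      exact measurable_const.max (this.comp h1)
    exact h2.comp_aemeasurable (hp.aemeasurable measurableSet_Icc)
  · obtain ⟨R, hR⟩ := isCompact_Icc.exists_bound_of_continuousOn hp
    obtain ⟨b, hb0, hb⟩ := hastar.exists_le_of_abs_le (c i) hη.1 R
    refine ⟨b, fun t ht => ?_⟩
    change |max 0 (astar (c i) η (increments (c i) fun l => W t l η) z)| ≤ b
    rw [abs_of_nonneg (le_max_left _ _)]
    exact hb _ (fun y => (abs_apply_le_norm _ y).trans (hR t ht)) z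

theorem bddMeasurableOn_couplingGenerator {n d : ℕ} (hn : 2 ≤ n) {T : ℝ}
    {f : Fin d → Vec d → Vec d → ℝ} {astar : Fin d → Vec d → Vec d → Vec d}
    (hastar : IsUniqueMinimizer f astar) {V U : ℝ → Fin d → Vec d → ℝ}
    (hV : ∀ x, ∀ η ∈ lattice d (n - 1), ContinuousOn (fun t => V t x η) (Icc 0 T))
    (hU : ∀ x, ∀ η ∈ lattice d (n - 1), ContinuousOn (fun t => U t x η) (Icc 0 T))
    (φ : CoupledState n d → ℝ) (σ : CoupledState n d) :
    BddMeasurableOn T fun t => couplingGenerator astar V U t φ σ := by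
  unfold couplingGenerator
  refine BddMeasurableOn.sum _ fun i _ => BddMeasurableOn.sum _ fun z _ => ?_
  have hX := bddMeasurableOn_playerRate hn hastar hV σ.1 i z
  have hY := bddMeasurableOn_playerRate hn hastar hU σ.2.1 i z
  have hm := hX.min hY
  dsimp only
  split_ifs
  · exact ((hm.mul (.const T _)).add ((hX.sub hm).mul (.const T _))).add
      ((hY.sub hm).mul (.const T _))
  · exact (hX.mul (.const T _)).add (hY.mul (.const T _))

/-! ### Symmetry of the generator -/

/-- Relabelling of the players. -/
def permuteState {n : ℕ} (d : ℕ) (π : Equiv.Perm (Fin n)) : CoupledState n d ≃ CoupledState n d where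
  toFun σ := (σ.1 ∘ π, σ.2.1 ∘ π, σ.2.2 ∘ π)
  invFun σ := (σ.1 ∘ π.symm, σ.2.1 ∘ π.symm, σ.2.2 ∘ π.symm)
  left_inv σ := by simp [Function.comp_assoc]
  right_inv σ := by simp [Function.comp_assoc]

theorem othersMeasure_comp_perm {n d : ℕ} (π : Equiv.Perm (Fin n)) (c : Fin n → Fin d)
    (i : Fin n) : othersMeasure (c ∘ π) i = othersMeasure c (π i) := by
  unfold othersMeasure
  congr 1
  refine Finset.sum_bij (fun j _ => π j) (fun j hj => ?_) (fun j _ k _ h => π.injective h)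
    (fun j hj => ?_) (fun j _ => rfl)
  · exact Finset.mem_erase.2
      ⟨fun h => Finset.ne_of_mem_erase hj (π.injective h), Finset.mem_univ _⟩
  · refine ⟨π.symm j, Finset.mem_erase.2 ⟨fun h => ?_, Finset.mem_univ _⟩, by simp⟩
    exact Finset.ne_of_mem_erase hj (by rw [← h]; simp)

theorem playerRate_comp_perm {n d : ℕ} (astar : Fin d → Vec d → Vec d → Vec d)
    (W : ℝ → Fin d → Vec d → ℝ) (t : ℝ) (π : Equiv.Perm (Fin n)) (c : Fin n → Fin d) (i : Fin n)
    (z : Fin d) : playerRate astar W t (c ∘ π) i z = playerRate astar W t c (π i) z := by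
  simp only [playerRate, othersMeasure_comp_perm, Function.comp_apply]

/-- All players use the same feedback and see the others only through their empirical measure, so
relabelling merely reindexes the sum over players. -/
theorem couplingGenerator_permuteState {n d : ℕ} (astar : Fin d → Vec d → Vec d → Vec d)
    (V U : ℝ → Fin d → Vec d → ℝ) (t : ℝ) (φ : CoupledState n d → ℝ) (π : Equiv.Perm (Fin n))
    (σ : CoupledState n d) :
    couplingGenerator astar V U t φ (permuteState d π σ)
      = couplingGenerator astar V U t (fun ρ => φ (permuteState d π ρ)) σ := by
  have hupd : ∀ {α : Type} (c : Fin n → α) (i : Fin n) (z : α),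
      Function.update (c ∘ π) i z = Function.update c (π i) z ∘ π := by
    intro α c i z
    rw [Function.update_comp_equiv, Equiv.symm_apply_apply]
  unfold couplingGenerator
  conv_rhs => rw [← Equiv.sum_comp π]
  simp only [permuteState, Equiv.coe_fn_mk, playerRate_comp_perm, hupd, Function.comp_apply]

/-! ### Integrals along a process with finitely many states -/

theorem BddMeasurableOn.intervalIntegrable {T : ℝ} {u : ℝ → ℝ} (hu : BddMeasurableOn T u) {t : ℝ}
    (ht : t ∈ Icc 0 T) : IntervalIntegrable u volume 0 t := by
  obtain ⟨hm, b, hb⟩ := hu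
  rw [intervalIntegrable_iff_integrableOn_Ioc_of_le ht.1]
  have hsub : Ioc 0 t ⊆ Icc 0 T := fun s hs => ⟨hs.1.le, hs.2.trans ht.2⟩
  refine Integrable.of_bound
    (hm.mono_measure (Measure.restrict_mono hsub le_rfl)).aestronglyMeasurable b ?_
  filter_upwards [ae_restrict_mem measurableSet_Ioc] with s hs using hb s (hsub hs)

theorem bddMeasurableOn_measureReal {Ω S : Type*} [MeasurableSpace Ω] {P : Measure Ω}
    [IsProbabilityMeasure P] [MeasurableSpace S] [MeasurableSingletonClass S] {Z : ℝ → Ω → S}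
    (hZ : Measurable fun q : ℝ × Ω => Z q.1 q.2) (T : ℝ) (σ : S) : BddMeasurableOn T fun s => P.real (Z s ⁻¹' {σ}) := by
  refine ⟨Measurable.aemeasurable ?_, 1, fun s _ => ?_⟩
  · exact (measurable_measure_prodMk_left (ν := P) (hZ (measurableSet_singleton σ))).ennreal_toReal
  · rw [abs_of_nonneg measureReal_nonneg]
    exact measureReal_le_one

section Occupation

variable {Ω S : Type*} [MeasurableSpace Ω] {P : Measure Ω} [IsProbabilityMeasure P] [Fintype S]
  [MeasurableSpace S] [MeasurableSingletonClass S]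

theorem integral_comp_eq_sum {Z : Ω → S} (hZ : Measurable Z) (φ : S → ℝ) :
    ∫ ω, φ (Z ω) ∂P = ∑ σ, P.real (Z ⁻¹' {σ}) * φ σ := by
  have : IsProbabilityMeasure (P.map Z) := Measure.isProbabilityMeasure_map hZ.aemeasurable
  rw [← integral_map hZ.aemeasurable (measurable_of_finite φ).aestronglyMeasurable,
    integral_fintype Integrable.of_finite]
  refine Finset.sum_congr rfl fun σ _ => ?_
  rw [map_measureReal_apply hZ (measurableSet_singleton σ), smul_eq_mul]

/-- Fubini's theorem. Joint integrability follows by writing the integrand as a finite sum of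
indicators of `Z = σ` times functions of time alone. -/
theorem integral_intervalIntegral_comp_eq {Z : ℝ → Ω → S}
    (hZ : Measurable fun q : ℝ × Ω => Z q.1 q.2) {T : ℝ} {G : ℝ → S → ℝ}
    (hG : ∀ σ, BddMeasurableOn T fun s => G s σ) {t : ℝ} (ht : t ∈ Icc 0 T) :
    ∫ ω, (∫ s in (0 : ℝ)..t, G s (Z s ω)) ∂P
      = ∫ s in (0 : ℝ)..t, ∑ σ, P.real (Z s ⁻¹' {σ}) * G s σ := by
  classical
  have hsub : uIoc 0 t ⊆ Icc 0 T := by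
    rw [uIoc_of_le ht.1]
    exact fun s hs => ⟨hs.1.le, hs.2.trans ht.2⟩
  have hfin : IsFiniteMeasure (volume.restrict (uIoc 0 t)) := by
    rw [uIoc_of_le ht.1]
    infer_instance
  have hint : Integrable (Function.uncurry fun s ω => G s (Z s ω))
      ((volume.restrict (uIoc 0 t)).prod P) := by
    have heq : (Function.uncurry fun s ω => G s (Z s ω))
        = fun q : ℝ × Ω => ∑ σ, (if Z q.1 q.2 = σ then (1 : ℝ) else 0) * G q.1 σ := by
      ext q
      simp [Function.uncurry]
    rw [heq]
    refine integrable_finsetSum _ fun σ _ => ?_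
    obtain ⟨hm, b, hb⟩ := hG σ
    refine Integrable.of_bound (C := b) ?_ ?_
    · refine (Measurable.aestronglyMeasurable ?_).mul ?_
      · exact Measurable.ite (hZ (measurableSet_singleton σ)) measurable_const measurable_const
      · exact ((hm.mono_measure (Measure.restrict_mono hsub le_rfl)).comp_quasiMeasurePreserving
          Measure.quasiMeasurePreserving_fst).aestronglyMeasurable
    · have h1 : ∀ᵐ s ∂(volume.restrict (uIoc 0 t)), |G s σ| ≤ b := by
        filter_upwards [ae_restrict_mem measurableSet_uIoc] with s hs using hb s (hsub hs)
      filter_upwards [(Measure.quasiMeasurePreserving_fst (ν := P)).ae h1] with q hq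
      rw [Real.norm_eq_abs, abs_mul]
      refine le_trans (mul_le_of_le_one_left (abs_nonneg _) ?_) hq
      split_ifs <;> simp
  rw [← intervalIntegral_integral_swap hint]
  refine intervalIntegral.integral_congr fun s _ => ?_
  exact integral_comp_eq_sum (hZ.comp measurable_prodMk_left) (G s)

end Occupation

/-! ### Measurability of the coupled process and its forward equation -/

theorem HasCadlagPaths.exists_Ioo {n d : ℕ} {Ω : Type*} {T : ℝ} {X : ℝ → Ω → Fin n → Fin d}
    (h : HasCadlagPaths T X) (ω : Ω) {t : ℝ} (ht : t ∈ Ico 0 T) :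
    ∃ u, t < u ∧ ∀ s ∈ Ioo t u, X s ω = X t ω := by
  obtain ⟨u, hu, hs⟩ := (mem_nhdsGT_iff_exists_Ioo_subset).1 ((h ω).1 t ht)
  exact ⟨u, hu, fun s hsu => hs hsu⟩

section Coupling

variable {n d : ℕ} {Ω : Type*} [mΩ : MeasurableSpace Ω] {P : Measure Ω} {T : ℝ}
  {astar : Fin d → Vec d → Vec d → Vec d} {V U : ℝ → Fin d → Vec d → ℝ}
  {ℱ : Filtration (Icc (0 : ℝ) T) mΩ} {X Y : ℝ → Ω → Fin n → Fin d}

theorem IsCoupling.measurable_X (h : IsCoupling P T astar V U ℱ X Y) {t : ℝ} (ht : t ∈ Icc 0 T) :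
    Measurable (X t) := (h.adapted_X ⟨t, ht⟩).mono (ℱ.le _) le_rfl

theorem IsCoupling.measurable_Y (h : IsCoupling P T astar V U ℱ X Y) {t : ℝ} (ht : t ∈ Icc 0 T) :
    Measurable (Y t) := (h.adapted_Y ⟨t, ht⟩).mono (ℱ.le _) le_rfl

/-- By right-continuity a disagreement before time `t` persists up to a rational time before `t`, so
countably many times suffice together with the endpoint `t`, which must be kept separately. -/
theorem IsCoupling.measurableSet_apart (h : IsCoupling P T astar V U ℱ X Y) {t : ℝ}
    (ht : t ∈ Icc 0 T) (i : Fin n) :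
    MeasurableSet {ω | ∃ s ∈ Icc 0 t, X s ω i ≠ Y s ω i} := by
  have hne : ∀ s ∈ Icc 0 T, MeasurableSet {ω | X s ω i ≠ Y s ω i} := fun s hs =>
    (measurableSet_eq_fun ((measurable_pi_apply i).comp (h.measurable_X hs))
      ((measurable_pi_apply i).comp (h.measurable_Y hs))).compl
  have heq : {ω | ∃ s ∈ Icc 0 t, X s ω i ≠ Y s ω i} = {ω | X t ω i ≠ Y t ω i} ∪
      ⋃ q : ℚ, ⋃ _ : (q : ℝ) ∈ Ico 0 t, {ω | X q ω i ≠ Y q ω i} := by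
    ext ω
    simp only [mem_ofPred_eq, mem_union, mem_iUnion, exists_prop]
    constructor
    · rintro ⟨s, hs, hne⟩
      rcases eq_or_lt_of_le hs.2 with rfl | hst
      · exact Or.inl hne
      · have hsT : s ∈ Ico 0 T := ⟨hs.1, hst.trans_le ht.2⟩
        obtain ⟨u, hu, hXu⟩ := h.cadlag_X.exists_Ioo ω hsT
        obtain ⟨u', hu', hYu⟩ := h.cadlag_Y.exists_Ioo ω hsT
        obtain ⟨q, hq1, hq2⟩ := exists_rat_btwn (lt_min (lt_min hu hu') hst)
        refine Or.inr ⟨q, ⟨hs.1.trans hq1.le, hq2.trans_le (min_le_right _ _)⟩, ?_⟩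
        rw [hXu q ⟨hq1, hq2.trans_le ((min_le_left _ _).trans (min_le_left _ _))⟩,
          hYu q ⟨hq1, hq2.trans_le ((min_le_left _ _).trans (min_le_right _ _))⟩]
        exact hne
    · rintro (hne | ⟨q, hq, hne⟩)
      · exact ⟨t, ⟨ht.1, le_rfl⟩, hne⟩
      · exact ⟨q, ⟨hq.1, hq.2.le⟩, hne⟩
  rw [heq]
  refine (hne t ht).union (MeasurableSet.iUnion fun q => MeasurableSet.iUnion fun hq => hne _ ?_)
  exact ⟨hq.1, hq.2.le.trans ht.2⟩

theorem IsCoupling.measurable_coupledState (h : IsCoupling P T astar V U ℱ X Y) {t : ℝ}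
    (ht : t ∈ Icc 0 T) : Measurable (coupledState X Y t) := by
  refine (h.measurable_X ht).prodMk ((h.measurable_Y ht).prodMk (measurable_pi_lambda _ fun i => ?_))
  refine measurable_to_bool ?_
  convert h.measurableSet_apart ht i using 1
  ext ω
  simp

/-- Both configurations are frozen just after `t`, so a disagreement there was already present at
`t` and no new flag is raised. -/
theorem IsCoupling.coupledState_eventually_eq (h : IsCoupling P T astar V U ℱ X Y) (ω : Ω) {t : ℝ}
    (ht : t ∈ Ico 0 T) : ∀ᶠ s in 𝓝[>] t, coupledState X Y s ω = coupledState X Y t ω := by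
  obtain ⟨u, hu, hXu⟩ := h.cadlag_X.exists_Ioo ω ht
  obtain ⟨u', hu', hYu⟩ := h.cadlag_Y.exists_Ioo ω ht
  filter_upwards [Ioo_mem_nhdsGT (lt_min hu hu')] with s hs
  have hX : ∀ r ∈ Ioc t s, X r ω = X t ω := fun r hr =>
    hXu r ⟨hr.1, hr.2.trans_lt (hs.2.trans_le (min_le_left _ _))⟩
  have hY : ∀ r ∈ Ioc t s, Y r ω = Y t ω := fun r hr =>
    hYu r ⟨hr.1, hr.2.trans_lt (hs.2.trans_le (min_le_right _ _))⟩
  unfold coupledState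
  rw [hX s ⟨hs.1, le_rfl⟩, hY s ⟨hs.1, le_rfl⟩]
  congr 2
  funext i
  rw [decide_eq_decide]
  constructor
  · rintro ⟨r, hr, hne⟩
    rcases le_or_gt r t with hrt | hrt
    · exact ⟨r, ⟨hr.1, hrt⟩, hne⟩
    · rw [hX r ⟨hrt, hr.2⟩, hY r ⟨hrt, hr.2⟩] at hne
      exact ⟨t, ⟨ht.1, le_rfl⟩, hne⟩
  · rintro ⟨r, hr, hne⟩
    exact ⟨r, ⟨hr.1, hr.2.trans hs.1.le⟩, hne⟩

/-- The coupled process stopped at `T`, and constant before time `0`, is jointly measurable. -/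
theorem IsCoupling.measurable_uncurry_clamp (h : IsCoupling P T astar V U ℱ X Y) (hT : 0 < T) :
    Measurable fun q : ℝ × Ω => coupledState X Y (max 0 (min q.1 T)) q.2 := by
  refine measurable_uncurry_of_eventually_eq
    (Z := fun s ω => coupledState X Y (max 0 (min s T)) ω) (fun s => ?_) (fun ω s => ?_)
  · exact h.measurable_coupledState ⟨le_max_left _ _, max_le hT.le (min_le_right _ _)⟩
  · rcases lt_or_ge s 0 with hs | hs
    · filter_upwards [Ioo_mem_nhdsGT hs] with r hr
      rw [max_eq_left ((min_le_left _ _).trans hr.2.le), max_eq_left ((min_le_left _ _).trans hs.le)]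
    rcases lt_or_ge s T with hsT | hsT
    · filter_upwards [h.coupledState_eventually_eq ω ⟨hs, hsT⟩, Ioo_mem_nhdsGT hsT] with r hr hrT
      rw [min_eq_left hsT.le, max_eq_right hs, min_eq_left hrT.2.le,
        max_eq_right (hs.trans hrT.1.le), hr]
    · filter_upwards [self_mem_nhdsWithin] with r hr
      rw [min_eq_right hsT, min_eq_right (hsT.trans (le_of_lt hr))]

theorem clamp_eq {T t : ℝ} (ht : t ∈ Icc 0 T) : max 0 (min t T) = t := by
  rw [min_eq_left ht.2, max_eq_right ht.1]

/-- The probability that the coupled process, stopped at `T`, is in the state `σ` at time `t`. -/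
def stateProb (P : Measure Ω) (T : ℝ) (X Y : ℝ → Ω → Fin n → Fin d) (t : ℝ)
    (σ : CoupledState n d) : ℝ :=
  P.real (coupledState X Y (max 0 (min t T)) ⁻¹' {σ})

theorem stateProb_nonneg (t : ℝ) (σ : CoupledState n d) : 0 ≤ stateProb P T X Y t σ :=
  measureReal_nonneg

/-- The forward equation of the coupled process. -/
theorem IsCoupling.forward_equation [IsProbabilityMeasure P]
    (h : IsCoupling P T astar V U ℱ X Y) (hT : 0 < T)
    (hG : ∀ φ σ, BddMeasurableOn T fun s => couplingGenerator (n := n) astar V U s φ σ)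
    (φ : CoupledState n d → ℝ) {t : ℝ} (ht : t ∈ Icc 0 T) :
    ∑ σ, stateProb P T X Y t σ * φ σ = ∑ σ, stateProb P T X Y 0 σ * φ σ
      + ∫ s in (0 : ℝ)..t, ∑ σ, stateProb P T X Y s σ * couplingGenerator astar V U s φ σ := by
  have h0 : (0 : ℝ) ∈ Icc 0 T := ⟨le_rfl, hT.le⟩
  have hmart := (h.martingale φ).setIntegral_eq (i := ⟨0, h0⟩) (j := ⟨t, ht⟩) ht.1
    MeasurableSet.univ
  have hMint := (h.martingale φ).integrable ⟨t, ht⟩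
  simp only [setIntegral_univ, intervalIntegral.integral_same, sub_self, integral_zero] at hmart
  have hφi : ∀ s ∈ Icc 0 T, Integrable (fun ω => φ (coupledState X Y s ω)) P := by
    intro s hs
    exact Integrable.of_finite.comp_measurable (f := coupledState X Y s) (g := φ)
      (h.measurable_coupledState hs)
  have hd : Integrable (fun ω => φ (coupledState X Y t ω) - φ (coupledState X Y 0 ω)) P :=
    (hφi t ht).sub (hφi 0 h0)
  -- Integrability of the time integral is read off from the martingale, as a difference of
  -- integrable variables.
  have hI : Integrable
      (fun ω => ∫ s in (0 : ℝ)..t, couplingGenerator astar V U s φ (coupledState X Y s ω)) P := by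
    refine (hd.sub hMint).congr (Eventually.of_forall fun ω => ?_)
    simp
  have hclamp := h.measurable_uncurry_clamp hT
  have hval : ∀ s ∈ Icc 0 T, ∫ ω, φ (coupledState X Y s ω) ∂P
      = ∑ σ, stateProb P T X Y s σ * φ σ := by
    intro s hs
    rw [integral_comp_eq_sum (h.measurable_coupledState hs) φ]
    simp only [stateProb, clamp_eq hs]
  have hIval : ∫ ω, (∫ s in (0 : ℝ)..t,
        couplingGenerator astar V U s φ (coupledState X Y s ω)) ∂P
      = ∫ s in (0 : ℝ)..t, ∑ σ, stateProb P T X Y s σ * couplingGenerator astar V U s φ σ := by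
    refine Eq.trans ?_ (integral_intervalIntegral_comp_eq (P := P)
      (Z := fun s => coupledState X Y (max 0 (min s T))) hclamp (hG φ) ht)
    refine integral_congr_ae (Eventually.of_forall fun ω => ?_)
    refine intervalIntegral.integral_congr fun s hs => ?_
    rw [uIcc_of_le ht.1] at hs
    simp only [clamp_eq ⟨hs.1, hs.2.trans ht.2⟩]
  rw [integral_sub hd hI, integral_sub (hφi t ht) (hφi 0 h0), hval t ht, hval 0 h0, hIval] at hmart
  linarith

end Coupling

/-! ### Initial law and exchangeability -/

section Coupling

variable {n d : ℕ} {Ω : Type*} [mΩ : MeasurableSpace Ω] {P : Measure Ω} {T : ℝ}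
  {astar : Fin d → Vec d → Vec d → Vec d} {V U : ℝ → Fin d → Vec d → ℝ}
  {ℱ : Filtration (Icc (0 : ℝ) T) mΩ} {X Y : ℝ → Ω → Fin n → Fin d}

theorem IsCoupling.coupledState_zero (h : IsCoupling P T astar V U ℱ X Y) (ω : Ω) :
    coupledState X Y 0 ω = (X 0 ω, X 0 ω, fun _ => false) := by
  unfold coupledState
  rw [h.initial_eq ω]
  congr 2
  funext i
  rw [decide_eq_false_iff_not]
  rintro ⟨s, hs, hne⟩
  have : s = 0 := le_antisymm hs.2 hs.1
  subst this
  rw [h.initial_eq ω] at hne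
  exact hne rfl

theorem IsCoupling.measureReal_initial (h : IsCoupling P T astar V U ℱ X Y)
    (x : Fin n → Fin d) : P.real {ω | X 0 ω = x} = ∏ i, P.real {ω | X 0 ω i = x i} := by
  have h1 := h.initial_indep.measure_inter_preimage_eq_mul Finset.univ
    (sets := fun i => ({x i} : Set (Fin d))) fun i _ => measurableSet_singleton _
  have h2 : {ω | X 0 ω = x} = ⋂ i ∈ (Finset.univ : Finset (Fin n)),
      (fun ω => X 0 ω i) ⁻¹' {x i} := by
    ext ω
    simp [funext_iff]
  rw [measureReal_def, h2, h1, ENNReal.toReal_prod]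
  rfl

theorem IsCoupling.stateProb_zero (h : IsCoupling P T astar V U ℱ X Y) (hT : 0 < T)
    (σ : CoupledState n d) : stateProb P T X Y 0 σ =
      if σ.2.1 = σ.1 ∧ σ.2.2 = fun _ => false then ∏ i, P.real {ω | X 0 ω i = σ.1 i} else 0 := by
  rw [stateProb, clamp_eq ⟨le_rfl, hT.le⟩]
  obtain ⟨x, y, b⟩ := σ
  simp only
  split_ifs with hc
  · obtain ⟨rfl, rfl⟩ := hc
    rw [← h.measureReal_initial]
    congr 1
    ext ω
    simp [h.coupledState_zero]
  · have : coupledState X Y 0 ⁻¹' {(x, y, b)} = ∅ := by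
      refine eq_empty_of_forall_notMem fun ω hω => hc ?_
      rw [mem_preimage, mem_singleton_iff, h.coupledState_zero, Prod.mk.injEq, Prod.mk.injEq] at hω
      exact ⟨hω.2.1.symm.trans hω.1, hω.2.2.symm⟩
    rw [this, measureReal_empty]

/-- The initial configuration has a product law with equal factors, the second configuration copies
it, and all flags are unset. -/
theorem IsCoupling.stateProb_zero_permuteState (h : IsCoupling P T astar V U ℱ X Y) (hT : 0 < T)
    (π : Equiv.Perm (Fin n)) (σ : CoupledState n d) :
    stateProb P T X Y 0 (permuteState d π σ) = stateProb P T X Y 0 σ := by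
  rw [h.stateProb_zero hT, h.stateProb_zero hT]
  have h1 : ((permuteState d π σ).2.1 = (permuteState d π σ).1 ∧
      (permuteState d π σ).2.2 = fun _ => false) ↔ (σ.2.1 = σ.1 ∧ σ.2.2 = fun _ => false) := by
    change (σ.2.1 ∘ π = σ.1 ∘ π ∧ σ.2.2 ∘ π = (fun _ => false) ∘ π) ↔ _
    rw [π.surjective.injective_comp_right.eq_iff, π.surjective.injective_comp_right.eq_iff]
  have h2 : ∏ i, P.real {ω | X 0 ω i = (permuteState d π σ).1 i}
      = ∏ i, P.real {ω | X 0 ω i = σ.1 i} := by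
    rw [← Equiv.prod_comp π fun i => P.real {ω | X 0 ω i = σ.1 i}]
    refine Finset.prod_congr rfl fun i _ => ?_
    rw [measureReal_def, measureReal_def]
    congr 1
    exact (h.initial_ident i (π i)).measure_mem_eq (measurableSet_singleton (σ.1 (π i)))
  simp only [h1, h2]

/-- The law of the coupled process is invariant under relabelling of the players. -/
theorem IsCoupling.stateProb_permuteState [IsProbabilityMeasure P]
    (h : IsCoupling P T astar V U ℱ X Y) (hT : 0 < T)
    (hG : ∀ φ σ, BddMeasurableOn T fun s => couplingGenerator (n := n) astar V U s φ σ)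
    (π : Equiv.Perm (Fin n)) {t : ℝ} (ht : t ∈ Icc 0 T) (σ : CoupledState n d) :
    stateProb P T X Y t (permuteState d π σ) = stateProb P T X Y t σ := by
  classical
  set ι : CoupledState n d → CoupledState n d → ℝ := fun ρ σ => if σ = ρ then 1 else 0 with hι
  set v := stateProb P T X Y with hv
  set a := permuteState d π with ha
  have hvmeas : ∀ σ, BddMeasurableOn T fun s => v s σ := fun σ =>
    bddMeasurableOn_measureReal (P := P) (Z := fun s => coupledState X Y (max 0 (min s T)))
      (h.measurable_uncurry_clamp hT) T σ
  have hsum : ∀ s ρ, ∑ σ, v s σ * ι ρ σ = v s ρ := fun s ρ => by simp [hι]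
  have hforward : ∀ ρ, ∀ t ∈ Icc 0 T, v t ρ = v 0 ρ
      + ∫ s in (0 : ℝ)..t, ∑ σ, v s σ * couplingGenerator astar V U s (ι ρ) σ := by
    intro ρ t ht
    have := h.forward_equation hT hG (ι ρ) ht
    rwa [hsum, hsum] at this
  have hperm : ∀ ρ, ∀ t ∈ Icc 0 T, v t (a ρ) = v 0 (a ρ)
      + ∫ s in (0 : ℝ)..t, ∑ σ, v s (a σ) * couplingGenerator astar V U s (ι ρ) σ := by
    intro ρ t ht
    rw [hforward (a ρ) t ht]
    congr 2
    ext s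
    rw [← Equiv.sum_comp a]
    refine Finset.sum_congr rfl fun σ _ => ?_
    rw [ha, couplingGenerator_permuteState]
    congr 2
    ext τ
    simp [hι]
  have hdiff : ∀ ρ, ∀ t ∈ Icc 0 T, v t (a ρ) - v t ρ
      = ∫ s in (0 : ℝ)..t, ∑ σ, (v s (a σ) - v s σ) * couplingGenerator astar V U s (ι ρ) σ := by
    intro ρ t ht
    rw [hperm ρ t ht, hforward ρ t ht, hv, ha, h.stateProb_zero_permuteState hT, ← hv, ← ha,
      add_sub_add_left_eq_sub, ← intervalIntegral.integral_sub]
    · refine intervalIntegral.integral_congr fun s _ => ?_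
      simp only [sub_mul, Finset.sum_sub_distrib]
    · exact (BddMeasurableOn.sum _ fun σ _ => (hvmeas (a σ)).mul (hG (ι ρ) σ)).intervalIntegrable ht
    · exact (BddMeasurableOn.sum _ fun σ _ => (hvmeas σ).mul (hG (ι ρ) σ)).intervalIntegrable ht
  choose b hb using fun ρ σ => (hG (ι ρ) σ).2
  set B := ∑ ρ, ∑ σ, |b ρ σ| with hB
  have hBle : ∀ ρ σ, ∀ s ∈ Icc 0 T, |couplingGenerator astar V U s (ι ρ) σ| ≤ B := by
    intro ρ σ s hs
    refine (hb ρ σ s hs).trans ((le_abs_self _).trans ?_)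
    refine (Finset.single_le_sum (f := fun σ => |b ρ σ|) (fun i _ => abs_nonneg _)
      (Finset.mem_univ σ)).trans ?_
    exact Finset.single_le_sum (f := fun ρ => ∑ σ, |b ρ σ|)
      (fun i _ => Finset.sum_nonneg fun j _ => abs_nonneg _) (Finset.mem_univ ρ)
  have hB0 : 0 ≤ B := Finset.sum_nonneg fun i _ => Finset.sum_nonneg fun j _ => abs_nonneg _
  -- The `ℓ¹` distance between the law and its relabelling. It vanishes at time `0`, so Grönwall's
  -- inequality applies with `A = 0` and forces it to vanish throughout.
  set w : ℝ → ℝ := fun s => ∑ σ, |v s (a σ) - v s σ| with hw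
  have hw0 : ∀ s, 0 ≤ w s := fun s => Finset.sum_nonneg fun σ _ => abs_nonneg _
  have hwm : BddMeasurableOn T w :=
    BddMeasurableOn.sum _ fun σ _ => ((hvmeas (a σ)).sub (hvmeas σ)).abs
  obtain ⟨M, hM⟩ := hwm.2
  have hone : ∀ ρ, ∀ t ∈ Icc 0 T, |v t (a ρ) - v t ρ| ≤ B * ∫ s in (0 : ℝ)..t, w s := by
    intro ρ t ht
    rw [hdiff ρ t ht, ← intervalIntegral.integral_const_mul, ← Real.norm_eq_abs]
    refine intervalIntegral.norm_integral_le_of_norm_le ht.1 (Eventually.of_forall fun s hs => ?_)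
      ((hwm.intervalIntegrable ht).const_mul B)
    rw [hw, Finset.mul_sum]
    refine (norm_sum_le _ _).trans (Finset.sum_le_sum fun σ _ => ?_)
    rw [norm_mul, mul_comm]
    exact mul_le_mul_of_nonneg_right (hBle ρ σ s ⟨hs.1.le, hs.2.trans ht.2⟩) (norm_nonneg _)
  have hgron := le_two_mul_exp_of_le_integral (w := w) (A := 0)
    (C := Fintype.card (CoupledState n d) * B) (T := T) (M := M) (by positivity) hT.le
    (fun s _ => hw0 s) (fun s hs => (le_abs_self _).trans (hM s hs)) (fun s hs => by
      refine (Finset.sum_le_sum fun ρ _ => hone ρ s hs).trans (le_of_eq ?_)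
      simp [mul_assoc]) t ht
  rw [mul_zero, zero_mul] at hgron
  have hzero : |v t (a σ) - v t σ| ≤ 0 :=
    (Finset.single_le_sum (f := fun σ => |v t (a σ) - v t σ|) (fun i _ => abs_nonneg _)
      (Finset.mem_univ σ)).trans hgron
  exact sub_eq_zero.1 (abs_nonpos_iff.1 hzero)

/-! ### Probability of separation -/

/-- The event that the two copies of player `i` have been apart by time `t`. -/
def apart (X Y : ℝ → Ω → Fin n → Fin d) (t : ℝ) (i : Fin n) : Set Ω :=
  {ω | ∃ s ∈ Icc 0 t, X s ω i ≠ Y s ω i}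

/-- The flag of player `i`, as a number. -/
def flag (i : Fin n) (σ : CoupledState n d) : ℝ := if σ.2.2 i = true then 1 else 0

theorem flag_nonneg (i : Fin n) (σ : CoupledState n d) : 0 ≤ flag i σ := by
  unfold flag; split_ifs <;> norm_num

theorem IsCoupling.measureReal_apart [IsProbabilityMeasure P]
    (h : IsCoupling P T astar V U ℱ X Y) {t : ℝ} (ht : t ∈ Icc 0 T) (i : Fin n) :
    P.real (apart X Y t i) = ∑ σ, stateProb P T X Y t σ * flag i σ := by
  have h1 := integral_comp_eq_sum (P := P) (h.measurable_coupledState ht) (flag i)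
  simp only [stateProb, clamp_eq ht]
  have hm : MeasurableSet (apart X Y t i) := h.measurableSet_apart ht i
  rw [← h1, ← integral_indicator_one hm]
  refine integral_congr_ae (Eventually.of_forall fun ω => ?_)
  have hflag : (coupledState X Y t ω).2.2 i = true ↔ ω ∈ apart X Y t i := by
    unfold coupledState
    simp only [decide_eq_true_eq]
    rfl
  simp only [flag]
  by_cases hω : ω ∈ apart X Y t i
  · rw [indicator_of_mem hω, if_pos (hflag.2 hω), Pi.one_apply]
  · rw [indicator_of_notMem hω, if_neg (hflag.not.2 hω)]

theorem IsCoupling.measureReal_apart_eq [IsProbabilityMeasure P]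
    (h : IsCoupling P T astar V U ℱ X Y) (hT : 0 < T)
    (hG : ∀ φ σ, BddMeasurableOn T fun s => couplingGenerator (n := n) astar V U s φ σ)
    {t : ℝ} (ht : t ∈ Icc 0 T) (i j : Fin n) :
    P.real (apart X Y t j) = P.real (apart X Y t i) := by
  rw [h.measureReal_apart ht, h.measureReal_apart ht,
    ← Equiv.sum_comp (permuteState d (Equiv.swap i j))]
  refine Finset.sum_congr rfl fun σ _ => ?_
  rw [h.stateProb_permuteState hT hG _ ht]
  simp [flag, permuteState]

/-- Lets the generator be estimated only at states the process can visit, where unflagged players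
agree. -/
theorem IsCoupling.eq_of_stateProb_ne_zero {t : ℝ} (ht : t ∈ Icc 0 T) {σ : CoupledState n d}
    (hσ : stateProb P T X Y t σ ≠ 0) (i : Fin n) (hi : σ.2.2 i = false) : σ.1 i = σ.2.1 i := by
  rw [stateProb, clamp_eq ht] at hσ
  obtain ⟨ω, hω⟩ : (coupledState X Y t ⁻¹' {σ}).Nonempty := by
    rw [nonempty_iff_ne_empty]
    intro he
    rw [he, measureReal_empty] at hσ
    exact hσ rfl
  have hω' : coupledState X Y t ω = σ := hω
  subst hω'
  by_contra hne
  simp only [coupledState, decide_eq_false_iff_not] at hi hne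
  exact hi ⟨t, ⟨ht.1, le_rfl⟩, hne⟩

end Coupling

/-- Only a jump of player `i` alone in one of the games raises its flag, and the two excess rates
over the minimum add up to the absolute difference. -/
theorem couplingGenerator_flag {n d : ℕ} (astar : Fin d → Vec d → Vec d → Vec d)
    (V U : ℝ → Fin d → Vec d → ℝ) (t : ℝ) (i : Fin n) (σ : CoupledState n d) :
    couplingGenerator astar V U t (flag i) σ = if σ.2.2 i = true then 0 else
      ∑ z, |playerRate astar V t σ.1 i z - playerRate astar U t σ.2.1 i z| := by
  obtain ⟨x, y, b⟩ := σ
  unfold couplingGenerator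
  simp only [flag]
  rw [Finset.sum_eq_single i]
  · by_cases hb : b i = true
    · simp [hb]
    · rw [Bool.not_eq_true] at hb
      simp only [hb, if_true, Bool.false_eq_true, if_false, Function.update_self, sub_self,
        mul_zero, sub_zero, mul_one, zero_add]
      refine Finset.sum_congr rfl fun z _ => ?_
      rcases le_total (playerRate astar V t x i z) (playerRate astar U t y i z) with hle | hle
      · rw [min_eq_left hle, abs_of_nonpos (sub_nonpos.2 hle)]; ring
      · rw [min_eq_right hle, abs_of_nonneg (sub_nonneg.2 hle)]; ring
  · intro j _ hj
    refine Finset.sum_eq_zero fun z _ => ?_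
    simp [Function.update_of_ne hj.symm]
  · simp

theorem norm_basisVec_sub_le {d : ℕ} {x y : Fin d} {b : ℝ} (hb : 0 ≤ b) (h : x ≠ y → 1 ≤ b) :
    ‖basisVec x - basisVec y‖ ≤ 2 * b := by
  by_cases hxy : x = y
  · rw [hxy, sub_self, norm_zero]; positivity
  · have := norm_moveVec_le y x
    rw [moveVec] at this
    linarith [h hxy]

theorem norm_othersMeasure_sub_le {n d : ℕ} (hn : 2 ≤ n) (x y : Fin n → Fin d) (i : Fin n)
    {b : Fin n → ℝ} (hb : ∀ j, 0 ≤ b j) (h : ∀ j, x j ≠ y j → 1 ≤ b j) :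
    ‖othersMeasure x i - othersMeasure y i‖
      ≤ (1 / ((n : ℝ) - 1)) * ∑ j ∈ Finset.univ.erase i, 2 * b j := by
  have hN := cast_sub_one_pos hn
  rw [othersMeasure, othersMeasure, ← smul_sub, ← Finset.sum_sub_distrib, norm_smul,
    Real.norm_of_nonneg (by positivity)]
  refine mul_le_mul_of_nonneg_left ?_ (by positivity)
  exact (norm_sum_le _ _).trans
    (Finset.sum_le_sum fun j _ => norm_basisVec_sub_le (hb j) (h j))

theorem norm_fullMeasure_sub_le {n d : ℕ} (x y : Fin n → Fin d)
    {b : Fin n → ℝ} (hb : ∀ j, 0 ≤ b j) (h : ∀ j, x j ≠ y j → 1 ≤ b j) :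
    ‖fullMeasure x - fullMeasure y‖ ≤ (1 / (n : ℝ)) * ∑ j, 2 * b j := by
  rw [fullMeasure, fullMeasure, ← smul_sub, ← Finset.sum_sub_distrib, norm_smul,
    Real.norm_of_nonneg (by positivity)]
  refine mul_le_mul_of_nonneg_left ?_ (by positivity)
  exact (norm_sum_le _ _).trans
    (Finset.sum_le_sum fun j _ => norm_basisVec_sub_le (hb j) (h j))

/-- The rate at which the two copies of a player separate. -/
theorem UniformBounds.couplingGenerator_flag_le {n d : ℕ} (hn : 2 ≤ n) {T : ℝ}
    {f : Fin d → Vec d → Vec d → ℝ}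
    {astar : Fin d → Vec d → Vec d → Vec d} {V U : ℝ → Fin d → Vec d → ℝ}
    {gradU : ℝ → Fin d → Vec d → Vec d} {δ L ε : ℝ} (h : UniformBounds T f astar U gradU δ L)
    (hε : ε ≤ δ) {t : ℝ} (ht : t ∈ Icc 0 T)
    (hV : ∀ x, ∀ η ∈ lattice d (n - 1), |V t x η - U t x η| ≤ ε)
    (i : Fin n) {σ : CoupledState n d} (hσ : ∀ j, σ.2.2 j = false → σ.1 j = σ.2.1 j) :
    couplingGenerator astar V U t (flag i) σ ≤
      d * L * ((1 / ((n : ℝ) - 1)) * ∑ j ∈ Finset.univ.erase i, 2 * flag j σ + ε) := by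
  have hN := cast_sub_one_pos hn
  obtain ⟨x, y, b⟩ := σ
  have hη' := othersMeasure_mem_lattice hn x i
  have hη := othersMeasure_mem_lattice hn y i
  have hL := h.const_nonneg
  have hε0 : 0 ≤ ε := (abs_nonneg _).trans (hV (x i) _ hη')
  set R := (1 / ((n : ℝ) - 1)) * ∑ j ∈ Finset.univ.erase i, 2 * flag j (x, y, b) with hR
  have hR0 : 0 ≤ R :=
    mul_nonneg (by positivity) (Finset.sum_nonneg fun j _ => mul_nonneg two_pos.le (flag_nonneg _ _))
  have hdist : ‖othersMeasure x i - othersMeasure y i‖ ≤ R := by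
    refine norm_othersMeasure_sub_le hn x y i (b := fun j => flag j (x, y, b))
      (fun j => flag_nonneg _ _) fun j hj => ?_
    by_cases hbj : b j = true
    · simp [flag, hbj]
    · exact absurd (hσ j (Bool.not_eq_true _ ▸ hbj)) hj
  rw [couplingGenerator_flag]
  simp only
  split_ifs with hb
  · positivity
  -- Essential for the comparison of rates: the Lipschitz estimate for `astar` compares controls at
  -- one and the same state.
  have hxy : x i = y i := hσ i (Bool.not_eq_true _ ▸ hb)
  have hz : ∀ z, |playerRate astar V t x i z - playerRate astar U t y i z| ≤ L * (R + ε) := by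
    intro z
    have h1 := h.astar_close t ht (y i) _ hη.1 _ hη'.1 (fun l => V t l (othersMeasure x i)) ε hε
      fun l => hV l _ hη'
    rw [playerRate, playerRate, hxy]
    refine (abs_max_sub_max_le_max _ _ _ _).trans ?_
    rw [sub_self, abs_zero, max_eq_right (abs_nonneg _), ← PiLp.sub_apply]
    refine (abs_apply_le_norm _ z).trans (h1.trans (mul_le_mul_of_nonneg_left ?_ hL))
    linarith
  refine (Finset.sum_le_sum fun z _ => hz z).trans (le_of_eq ?_)
  simp [mul_assoc]

theorem RegularityAssumption.bddMeasurableOn_couplingGenerator {d : ℕ} {T : ℝ}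
    {f : Fin d → Vec d → Vec d → ℝ} {g : Fin d → Vec d → ℝ}
    {astar : Fin d → Vec d → Vec d → Vec d} {V : ℕ → ℝ → Fin d → Vec d → ℝ}
    {U : ℝ → Fin d → Vec d → ℝ} {gradU : ℝ → Fin d → Vec d → Vec d}
    (hreg : RegularityAssumption T f g astar V U gradU) (hastar : IsUniqueMinimizer f astar)
    {n : ℕ} (hn : 2 ≤ n) (φ : CoupledState n d → ℝ) (σ : CoupledState n d) :
    BddMeasurableOn T fun s => couplingGenerator astar (V n) U s φ σ :=
  FiniteGame.bddMeasurableOn_couplingGenerator hn hastar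
    (fun x η hη t ht => ((hreg.hjb n hn).deriv t ht x η hη).continuousWithinAt)
    (fun x η hη t ht => (hreg.master.deriv t ht x η hη.1).continuousWithinAt) φ σ

/-- The probability that the two copies of a player separate, in terms of the distance `ε` of the
value functions. -/
theorem UniformBounds.measureReal_apart_le {n d : ℕ} (hn : 2 ≤ n) {T : ℝ} (hT : 0 < T)
    {f : Fin d → Vec d → Vec d → ℝ}
    {astar : Fin d → Vec d → Vec d → Vec d} {V U : ℝ → Fin d → Vec d → ℝ}
    {gradU : ℝ → Fin d → Vec d → Vec d} {δ L ε : ℝ} (h : UniformBounds T f astar U gradU δ L)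
    (hε0 : 0 ≤ ε) (hε : ε ≤ δ)
    (hV : ∀ t ∈ Icc 0 T, ∀ x, ∀ η ∈ lattice d (n - 1), |V t x η - U t x η| ≤ ε)
    (hG : ∀ φ σ, BddMeasurableOn T fun s => couplingGenerator (n := n) astar V U s φ σ)
    {Ω : Type*} [mΩ : MeasurableSpace Ω] {P : Measure Ω} [IsProbabilityMeasure P]
    {ℱ : Filtration (Icc (0 : ℝ) T) mΩ} {X Y : ℝ → Ω → Fin n → Fin d}
    (hc : IsCoupling P T astar V U ℱ X Y) (i : Fin n) :
    P.real (apart X Y T i) ≤ 2 * (d * L * ε * T) * Real.exp (2 * (d * L * 2) * T) := by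
  have hN := cast_sub_one_pos hn
  have hL := h.const_nonneg
  set p : ℝ → ℝ := fun t => ∑ σ, stateProb P T X Y t σ * flag i σ with hp
  have hpa : ∀ t ∈ Icc 0 T, P.real (apart X Y t i) = p t := fun t ht => hc.measureReal_apart ht i
  have hvmeas : ∀ σ, BddMeasurableOn T fun s => stateProb P T X Y s σ := fun σ =>
    bddMeasurableOn_measureReal (P := P) (Z := fun s => coupledState X Y (max 0 (min s T)))
      (hc.measurable_uncurry_clamp hT) T σ
  have hpm : BddMeasurableOn T p :=
    BddMeasurableOn.sum _ fun σ _ => (hvmeas σ).mul (.const T _)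
  have hp0 : p 0 = 0 := by
    have h0 : (0 : ℝ) ∈ Icc 0 T := ⟨le_rfl, hT.le⟩
    have hempty : apart X Y 0 i = ∅ := by
      refine eq_empty_of_forall_notMem fun ω => ?_
      rintro ⟨s, hs, hne⟩
      have : s = 0 := le_antisymm hs.2 hs.1
      subst this
      exact hne (by rw [hc.initial_eq ω])
    rw [← hpa 0 h0, hempty, measureReal_empty]
  have hmass : ∀ t ∈ Icc 0 T, ∑ σ, stateProb P T X Y t σ = 1 := by
    intro t ht
    have := integral_comp_eq_sum (P := P) (hc.measurable_coupledState ht) fun _ => 1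
    simp only [integral_const, probReal_univ, smul_eq_mul, mul_one] at this
    simp only [stateProb, clamp_eq ht]
    exact this.symm
  have hdrift : ∀ t ∈ Icc 0 T,
      ∑ σ, stateProb P T X Y t σ * couplingGenerator astar V U t (flag i) σ
        ≤ d * L * ε + d * L * 2 * p t := by
    intro t ht
    have h1 : ∀ σ, stateProb P T X Y t σ * couplingGenerator astar V U t (flag i) σ
        ≤ stateProb P T X Y t σ * (d * L * ((1 / ((n : ℝ) - 1)) *
          ∑ j ∈ Finset.univ.erase i, 2 * flag j σ + ε)) := by
      intro σ
      by_cases hσ : stateProb P T X Y t σ = 0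
      · rw [hσ, zero_mul, zero_mul]
      · exact mul_le_mul_of_nonneg_left (h.couplingGenerator_flag_le hn hε ht (hV t ht) i
          fun j hj => IsCoupling.eq_of_stateProb_ne_zero ht hσ j hj) (stateProb_nonneg t σ)
    refine (Finset.sum_le_sum fun σ _ => h1 σ).trans (le_of_eq ?_)
    -- Exchangeability closes the inequality: the average of the other players' separation
    -- probabilities is `p t` itself.
    have h2 : ∀ j, ∑ σ, stateProb P T X Y t σ * flag j σ = p t := by
      intro j
      rw [← hc.measureReal_apart ht j, hc.measureReal_apart_eq hT hG ht i j, hpa t ht]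
    have h3 : ∀ σ, stateProb P T X Y t σ * (d * L * ((1 / ((n : ℝ) - 1)) *
          ∑ j ∈ Finset.univ.erase i, 2 * flag j σ + ε))
        = d * L * 2 * (1 / ((n : ℝ) - 1)) *
            (∑ j ∈ Finset.univ.erase i, stateProb P T X Y t σ * flag j σ)
          + d * L * ε * stateProb P T X Y t σ := by
      intro σ
      rw [← Finset.mul_sum, ← Finset.mul_sum]
      ring
    simp only [h3]
    rw [Finset.sum_add_distrib, ← Finset.mul_sum, ← Finset.mul_sum, hmass t ht, Finset.sum_comm]
    simp only [h2, Finset.sum_const, Finset.card_erase_of_mem (Finset.mem_univ i),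
      Finset.card_univ, Fintype.card_fin, nsmul_eq_mul, cast_sub_one_eq hn]
    field_simp
    ring
  have hgron := le_two_mul_exp_of_le_integral (w := p) (A := d * L * ε * T) (C := d * L * 2)
    (T := T) (M := 1) (by positivity) hT.le
    (fun t ht => by rw [← hpa t ht]; exact measureReal_nonneg)
    (fun t ht => by rw [← hpa t ht]; exact measureReal_le_one) (fun t ht => by
      have hf := hc.forward_equation hT hG (flag i) ht
      change p t = p 0 + _ at hf
      rw [hf, hp0, zero_add]
      have hi1 := (BddMeasurableOn.sum Finset.univ fun σ _ =>
        (hvmeas σ).mul (hG (flag i) σ)).intervalIntegrable ht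
      have hi2 := (hpm.intervalIntegrable ht).const_mul (d * L * 2)
      have hi3 : IntervalIntegrable (fun _ : ℝ => d * L * ε) volume 0 t :=
        intervalIntegrable_const
      refine (intervalIntegral.integral_mono_on ht.1 hi1 (hi3.add hi2)
        fun s hs => hdrift s ⟨hs.1, hs.2.trans ht.2⟩).trans ?_
      rw [intervalIntegral.integral_add hi3 hi2, intervalIntegral.integral_const,
        intervalIntegral.integral_const_mul, sub_zero, smul_eq_mul, mul_comm t]
      have : d * L * ε * t ≤ d * L * ε * T := mul_le_mul_of_nonneg_left ht.2 (by positivity)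
      linarith) T ⟨hT.le, le_rfl⟩
  rw [hpa T ⟨hT.le, le_rfl⟩]
  exact hgron

/-- Under the regularity assumption the two copies of a player separate with probability
`O(1 / n)`. -/
theorem RegularityAssumption.exists_measureReal_apart_le {d : ℕ} {T : ℝ} (hT : 0 < T)
    {f : Fin d → Vec d → Vec d → ℝ} {g : Fin d → Vec d → ℝ}
    {astar : Fin d → Vec d → Vec d → Vec d} {V : ℕ → ℝ → Fin d → Vec d → ℝ}
    {U : ℝ → Fin d → Vec d → ℝ} {gradU : ℝ → Fin d → Vec d → Vec d}
    (hreg : RegularityAssumption T f g astar V U gradU) (hastar : IsUniqueMinimizer f astar) :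
    ∃ C : ℝ, 0 < C ∧ ∀ n : ℕ, 2 ≤ n →
      ∀ (Ω : Type*) [mΩ : MeasurableSpace Ω] (P : Measure Ω) [IsProbabilityMeasure P]
        (ℱ : Filtration (Icc (0 : ℝ) T) mΩ) (X Y : ℝ → Ω → Fin n → Fin d),
        IsCoupling P T astar (V n) U ℱ X Y → ∀ i, P.real (apart X Y T i) ≤ C / n := by
  obtain ⟨δ, L, hub⟩ := hreg.exists_uniformBounds
  obtain ⟨n₀, C, hC, hV⟩ := hub.exists_abs_value_sub_le hastar hreg
  have hL := hub.const_nonneg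
  set E := Real.exp (2 * (d * L * 2) * T) with hE
  set C' := 2 * (d * L * T) * E * (2 * C) with hC'
  have hC'0 : 0 ≤ C' := by positivity
  -- The summand `n₀` covers `n < n₀`, where the bound is at least `1` and hence trivial for a
  -- probability; the `1` makes the constant positive.
  refine ⟨C' + n₀ + 1, by positivity, fun n hn Ω mΩ P _ ℱ X Y hc i => ?_⟩
  have hn' : (0 : ℝ) < n := by positivity
  have hN := cast_sub_one_pos hn
  rcases le_or_gt n₀ n with hn₀ | hn₀
  · obtain ⟨hCδ, hVU⟩ := hV n hn₀ hn
    have h1 := hub.measureReal_apart_le hn hT (by positivity) hCδ hVU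
      (fun φ σ => hreg.bddMeasurableOn_couplingGenerator hastar hn φ σ) hc i
    refine h1.trans ?_
    have h2 : C / ((n : ℝ) - 1) ≤ 2 * C / n := by
      rw [div_le_div_iff₀ hN hn']
      have : (2 : ℝ) ≤ n := by exact_mod_cast hn
      nlinarith
    calc 2 * (d * L * (C / ((n : ℝ) - 1)) * T) * E
        = 2 * (d * L * T) * E * (C / ((n : ℝ) - 1)) := by ring
      _ ≤ 2 * (d * L * T) * E * (2 * C / n) := mul_le_mul_of_nonneg_left h2 (by positivity)
      _ = C' / n := by rw [hC']; ring
      _ ≤ _ := div_le_div_of_nonneg_right (by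
          have : (0 : ℝ) ≤ n₀ := by positivity
          linarith) hn'.le
  · refine measureReal_le_one.trans ?_
    rw [one_le_div hn']
    have : (n : ℝ) ≤ n₀ := by exact_mod_cast hn₀.le
    linarith

/-! ### Distances in terms of separation -/

section Distances

variable {n d : ℕ} {Ω : Type*} {T : ℝ} {X Y : ℝ → Ω → Fin n → Fin d}

theorem one_le_indicator_apart {s : ℝ} (hs : s ∈ Icc 0 T) (ω : Ω) (j : Fin n)
    (h : X s ω j ≠ Y s ω j) : (1 : ℝ) ≤ (apart X Y T j).indicator (fun _ => 1) ω := by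
  have hω : ω ∈ apart X Y T j := ⟨s, hs, h⟩
  rw [indicator_of_mem hω]

theorem supOthersDist_le (hn : 2 ≤ n) (i : Fin n) (ω : Ω) :
    supOthersDist T X Y i ω ≤ ENNReal.ofReal ((1 / ((n : ℝ) - 1)) *
      ∑ j ∈ Finset.univ.erase i, 2 * (apart X Y T j).indicator (fun _ => 1) ω) :=
  iSup₂_le fun _ hs => ENNReal.ofReal_le_ofReal <|
    norm_othersMeasure_sub_le hn _ _ i
      (b := fun j => (apart X Y T j).indicator (fun _ => 1) ω)
      (fun _ => indicator_nonneg (fun _ _ => zero_le_one) _)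
      fun _ hj => one_le_indicator_apart hs ω _ hj

theorem supFullDist_le (ω : Ω) :
    supFullDist T X Y ω ≤ ENNReal.ofReal ((1 / (n : ℝ)) *
      ∑ j, 2 * (apart X Y T j).indicator (fun _ => 1) ω) :=
  iSup₂_le fun _ hs => ENNReal.ofReal_le_ofReal <|
    norm_fullMeasure_sub_le _ _
      (b := fun j => (apart X Y T j).indicator (fun _ => 1) ω)
      (fun _ => indicator_nonneg (fun _ _ => zero_le_one) _)
      fun _ hj => one_le_indicator_apart hs ω _ hj

theorem one_le_stateDist {x y : Fin d} (h : x ≠ y) : 1 ≤ stateDist x y := by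
  have h1 : ((x : ℕ) : ℤ) - ((y : ℕ) : ℤ) ≠ 0 := by
    intro h0
    exact h (Fin.ext (by omega))
  have h2 := Int.one_le_abs h1
  unfold stateDist
  exact_mod_cast h2

theorem stateDist_le {x y : Fin d} : stateDist x y ≤ d := by
  have hx : ((x : ℕ) : ℝ) ≤ d := by exact_mod_cast x.2.le
  have hy : ((y : ℕ) : ℝ) ≤ d := by exact_mod_cast y.2.le
  have hx0 : (0 : ℝ) ≤ ((x : ℕ) : ℝ) := by positivity
  have hy0 : (0 : ℝ) ≤ ((y : ℕ) : ℝ) := by positivity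
  unfold stateDist
  rw [abs_le]
  constructor <;> linarith

theorem indicator_apart_le_supStateDist (i : Fin n) (ω : Ω) :
    (apart X Y T i).indicator (fun _ => (1 : ℝ≥0∞)) ω ≤ supStateDist T X Y i ω := by
  by_cases hω : ω ∈ apart X Y T i
  · rw [indicator_of_mem hω]
    obtain ⟨s, hs, hne⟩ := hω
    refine le_trans ?_ (le_iSup₂ (f := fun s (_ : s ∈ Icc 0 T) =>
      ENNReal.ofReal (stateDist (X s ω i) (Y s ω i))) s hs)
    rw [← ENNReal.ofReal_one]
    exact ENNReal.ofReal_le_ofReal (one_le_stateDist hne)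
  · rw [indicator_of_notMem hω]
    exact zero_le

theorem supStateDist_le (i : Fin n) (ω : Ω) :
    supStateDist T X Y i ω ≤ (apart X Y T i).indicator (fun _ => ENNReal.ofReal d) ω := by
  refine iSup₂_le fun s hs => ?_
  by_cases hne : X s ω i = Y s ω i
  · rw [hne]
    simp [stateDist]
  · have hω : ω ∈ apart X Y T i := ⟨s, hs, hne⟩
    rw [indicator_of_mem hω]
    exact ENNReal.ofReal_le_ofReal stateDist_le

end Distances

theorem lintegral_ofReal_sum_indicator {n : ℕ} {Ω : Type*} [MeasurableSpace Ω] {P : Measure Ω}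
    [IsProbabilityMeasure P] {A : Fin n → Set Ω} (hA : ∀ j, MeasurableSet (A j)) {c : ℝ} (hc : 0 ≤ c) (s : Finset (Fin n)) :
    ∫⁻ ω, ENNReal.ofReal (c * ∑ j ∈ s, 2 * (A j).indicator (fun _ => 1) ω) ∂P
      = ENNReal.ofReal (c * ∑ j ∈ s, 2 * P.real (A j)) := by
  have hi : ∀ j, Integrable ((A j).indicator fun _ => (1 : ℝ)) P := fun j =>
    (integrable_const 1).indicator (hA j)
  rw [← ofReal_integral_eq_lintegral_ofReal]
  · rw [integral_const_mul, integral_finsetSum _ fun j _ => (hi j).const_mul 2]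
    congr 3
    funext j
    rw [integral_const_mul]
    congr 1
    exact integral_indicator_one (hA j)
  · exact (integrable_finsetSum _ fun j _ => (hi j).const_mul 2).const_mul c
  · exact Eventually.of_forall fun ω => mul_nonneg hc (Finset.sum_nonneg fun j _ =>
      mul_nonneg two_pos.le (indicator_nonneg (fun _ _ => zero_le_one) _))

theorem measurable_ofReal_sum_indicator {n : ℕ} {Ω : Type*} [MeasurableSpace Ω] {A : Fin n → Set Ω}
    (hA : ∀ j, MeasurableSet (A j)) (c : ℝ) (s : Finset (Fin n)) :
    Measurable fun ω => ENNReal.ofReal (c * ∑ j ∈ s, 2 * (A j).indicator (fun _ => 1) ω) := by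
  refine ENNReal.measurable_ofReal.comp (Measurable.const_mul ?_ c)
  exact Finset.measurable_sum _ fun j _ => (measurable_const.indicator (hA j)).const_mul 2

section Final

variable {n d : ℕ} {Ω : Type*} [mΩ : MeasurableSpace Ω] {P : Measure Ω} [IsProbabilityMeasure P]
  {T : ℝ} {X Y : ℝ → Ω → Fin n → Fin d}

/-- The majorant averages `2 * P.real (apart X Y T j)` over the `n - 1` other players. By symmetry
the average is `2 * P.real (apart X Y T i)`, and on that event the state distance reaches at least
`1`. -/
theorem lintegral_supOthersDist_le (hn : 2 ≤ n)
    (hm : ∀ j, MeasurableSet (apart X Y T j)) (i : Fin n)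
    (hsymm : ∀ j, P.real (apart X Y T j) = P.real (apart X Y T i)) :
    ∫⁻ ω, supOthersDist T X Y i ω ∂P ≤ 2 * ∫⁻ ω, supStateDist T X Y i ω ∂P := by
  have hN := cast_sub_one_pos hn
  calc ∫⁻ ω, supOthersDist T X Y i ω ∂P
      ≤ ∫⁻ ω, ENNReal.ofReal ((1 / ((n : ℝ) - 1)) *
          ∑ j ∈ Finset.univ.erase i, 2 * (apart X Y T j).indicator (fun _ => 1) ω) ∂P :=
        lintegral_mono fun ω => supOthersDist_le hn i ω
    _ = ENNReal.ofReal (2 * P.real (apart X Y T i)) := by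
        rw [lintegral_ofReal_sum_indicator hm (by positivity)]
        congr 1
        simp only [hsymm, Finset.sum_const, Finset.card_erase_of_mem (Finset.mem_univ i),
          Finset.card_univ, Fintype.card_fin, nsmul_eq_mul, cast_sub_one_eq hn]
        field_simp
    _ = 2 * ∫⁻ ω, (apart X Y T i).indicator (fun _ => (1 : ℝ≥0∞)) ω ∂P := by
        rw [lintegral_indicator (hm i), setLIntegral_const, one_mul,
          ENNReal.ofReal_mul two_pos.le, ofReal_measureReal]
        simp
    _ ≤ _ := by
        gcongr with ω
        exact indicator_apart_le_supStateDist i ω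

theorem lintegral_supStateDist_le (hm : ∀ j, MeasurableSet (apart X Y T j)) (i : Fin n) {r : ℝ}
    (hr : P.real (apart X Y T i) ≤ r) :
    2 * ∫⁻ ω, supStateDist T X Y i ω ∂P ≤ ENNReal.ofReal (2 * d * r) := by
  calc 2 * ∫⁻ ω, supStateDist T X Y i ω ∂P
      ≤ 2 * ∫⁻ ω, (apart X Y T i).indicator (fun _ => ENNReal.ofReal d) ω ∂P := by
        gcongr with ω
        exact supStateDist_le i ω
    _ = ENNReal.ofReal (2 * d * P.real (apart X Y T i)) := by
        rw [lintegral_indicator (hm i), setLIntegral_const, ENNReal.ofReal_mul (by positivity),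
          ENNReal.ofReal_mul two_pos.le, ofReal_measureReal, mul_assoc]
        simp
    _ ≤ _ := ENNReal.ofReal_le_ofReal (mul_le_mul_of_nonneg_left hr (by positivity))

theorem lintegral_sum_apart_le (hn : 2 ≤ n) (hm : ∀ j, MeasurableSet (apart X Y T j)) {r : ℝ}
    (hr : ∀ j, P.real (apart X Y T j) ≤ r) :
    ∫⁻ ω, ENNReal.ofReal ((1 / (n : ℝ)) *
      ∑ j, 2 * (apart X Y T j).indicator (fun _ => 1) ω) ∂P ≤ ENNReal.ofReal (2 * r) := by
  have hn' : (0 : ℝ) < n := by positivity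
  rw [lintegral_ofReal_sum_indicator hm (by positivity)]
  refine ENNReal.ofReal_le_ofReal ?_
  have h1 : ∑ j, 2 * P.real (apart X Y T j) ≤ ∑ _j : Fin n, 2 * r :=
    Finset.sum_le_sum fun j _ => mul_le_mul_of_nonneg_left (hr j) two_pos.le
  refine (mul_le_mul_of_nonneg_left h1 (by positivity)).trans (le_of_eq ?_)
  simp only [Finset.sum_const, Finset.card_univ, Fintype.card_fin, nsmul_eq_mul]
  field_simp

/-- Markov's inequality, applied to the measurable majorant `F` rather than to the supremum, whose
measurability is thus not needed. The rate is `√n * (1 / n) = 1 / √n`. -/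
theorem measure_sqrt_mul_supFullDist_le (hn : 2 ≤ n) (hm : ∀ j, MeasurableSet (apart X Y T j))
    {C : ℝ} (hr : ∀ j, P.real (apart X Y T j) ≤ C / n) {ε : ℝ} (hε : 0 < ε) :
    P {ω | ENNReal.ofReal ε ≤ ENNReal.ofReal (Real.sqrt n) * supFullDist T X Y ω}
      ≤ ENNReal.ofReal (2 * C / ε * (Real.sqrt n)⁻¹) := by
  have hn' : (0 : ℝ) < n := by positivity
  have hmeas := measurable_ofReal_sum_indicator hm (1 / (n : ℝ)) Finset.univ
  set F : Ω → ℝ≥0∞ := fun ω => ENNReal.ofReal ((1 / (n : ℝ)) *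
      ∑ j, 2 * (apart X Y T j).indicator (fun _ => 1) ω) with hF
  calc P {ω | ENNReal.ofReal ε ≤ ENNReal.ofReal (Real.sqrt n) * supFullDist T X Y ω}
      ≤ P {ω | ENNReal.ofReal ε ≤ ENNReal.ofReal (Real.sqrt n) * F ω} :=
        measure_mono fun ω hω => le_trans hω (mul_le_mul_right (supFullDist_le ω) _)
    _ ≤ (∫⁻ ω, ENNReal.ofReal (Real.sqrt n) * F ω ∂P) / ENNReal.ofReal ε :=
        meas_ge_le_lintegral_div (hmeas.const_mul _).aemeasurable
          (ENNReal.ofReal_pos.2 hε).ne' ENNReal.ofReal_ne_top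
    _ ≤ ENNReal.ofReal (Real.sqrt n) * ENNReal.ofReal (2 * (C / n)) / ENNReal.ofReal ε := by
        rw [lintegral_const_mul _ hmeas]
        gcongr
        exact lintegral_sum_apart_le hn hm hr
    _ = _ := by
        rw [← ENNReal.ofReal_mul (Real.sqrt_nonneg _), ← ENNReal.ofReal_div_of_pos hε]
        congr 1
        have hs : Real.sqrt n ≠ 0 := (Real.sqrt_pos.2 hn').ne'
        have hsq : Real.sqrt n * Real.sqrt n = n := Real.mul_self_sqrt hn'.le
        have hdiv : C / n = C / (Real.sqrt n * Real.sqrt n) := by rw [hsq]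
        rw [hdiv]
        field_simp

end Final

end FiniteGame

theorem proposition2p1 {d : ℕ} (hd : 2 ≤ d) {T : ℝ} (hT : 0 < T)
    (f : Fin d → FiniteGame.Vec d → FiniteGame.Vec d → ℝ)
    (g : Fin d → FiniteGame.Vec d → ℝ)
    (astar : Fin d → FiniteGame.Vec d → FiniteGame.Vec d → FiniteGame.Vec d)
    (V : ℕ → ℝ → Fin d → FiniteGame.Vec d → ℝ)
    (U : ℝ → Fin d → FiniteGame.Vec d → ℝ)
    (gradU : ℝ → Fin d → FiniteGame.Vec d → FiniteGame.Vec d)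
    (hastar : FiniteGame.IsUniqueMinimizer f astar)
    (hreg : FiniteGame.RegularityAssumption T f g astar V U gradU) :
    (∃ C : ℝ, 0 < C ∧ ∀ n : ℕ, 2 ≤ n →
      ∀ (Ω : Type*) [mΩ : MeasurableSpace Ω] (P : Measure Ω) [IsProbabilityMeasure P]
        (ℱ : Filtration (Icc (0 : ℝ) T) mΩ) (X Y : ℝ → Ω → Fin n → Fin d),
        FiniteGame.IsCoupling P T astar (V n) U ℱ X Y →
          (∀ i : Fin n,
            ∫⁻ ω, FiniteGame.supOthersDist T X Y i ω ∂P
                ≤ 2 * ∫⁻ ω, FiniteGame.supStateDist T X Y i ω ∂P ∧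
              2 * ∫⁻ ω, FiniteGame.supStateDist T X Y i ω ∂P ≤ ENNReal.ofReal (C / n)) ∧
          ∫⁻ ω, FiniteGame.supFullDist T X Y ω ∂P ≤ ENNReal.ofReal ((C + 2) / n)) ∧
    (∀ (Ω : ℕ → Type*) [mΩ : ∀ n, MeasurableSpace (Ω n)] (P : ∀ n, Measure (Ω n))
      [∀ n, IsProbabilityMeasure (P n)]
      (ℱ : ∀ n, Filtration (Icc (0 : ℝ) T) (mΩ n))
      (X Y : ∀ n, ℝ → Ω n → Fin n → Fin d),
      (∀ n, 2 ≤ n → FiniteGame.IsCoupling (P n) T astar (V n) U (ℱ n) (X n) (Y n)) →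
        ∀ ε : ℝ, 0 < ε →
          Tendsto (fun n : ℕ => P n {ω | ENNReal.ofReal ε ≤
            ENNReal.ofReal (Real.sqrt n) * FiniteGame.supFullDist T (X n) (Y n) ω})
            atTop (𝓝 0)) := by

  obtain ⟨C, hC, hbound⟩ := hreg.exists_measureReal_apart_le hT hastar
  -- The bound is taken twice because the two halves of the statement quantify over probability
  -- spaces in different universes.
  obtain ⟨C', hC', hbound'⟩ := hreg.exists_measureReal_apart_le hT hastar
  have hTmem : T ∈ Icc 0 T := ⟨hT.le, le_rfl⟩
  have hd1 : (1 : ℝ) ≤ d := by exact_mod_cast (by omega : 1 ≤ d)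
  refine ⟨⟨2 * d * C, by positivity, fun n hn Ω mΩ P _ ℱ X Y hc => ?_⟩,
    fun Ω mΩ P _ ℱ X Y hc ε hε => ?_⟩
  · have hm : ∀ j, MeasurableSet (FiniteGame.apart X Y T j) := fun j =>
      hc.measurableSet_apart hTmem j
    have hr := hbound n hn Ω P ℱ X Y hc
    have hn' : (0 : ℝ) < n := by positivity
    refine ⟨fun i => ⟨?_, ?_⟩, ?_⟩
    · exact FiniteGame.lintegral_supOthersDist_le hn hm i fun j => hc.measureReal_apart_eq hT
        (fun φ σ => hreg.bddMeasurableOn_couplingGenerator hastar hn φ σ) hTmem i j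
    · rw [mul_div_assoc]
      exact FiniteGame.lintegral_supStateDist_le hm i (hr i)
    · refine (lintegral_mono fun ω => FiniteGame.supFullDist_le ω).trans
        ((FiniteGame.lintegral_sum_apart_le hn hm hr).trans (ENNReal.ofReal_le_ofReal ?_))
      rw [← mul_div_assoc]
      refine div_le_div_of_nonneg_right ?_ hn'.le
      -- `2 * C ≤ 2 * d * C + 2`, because `1 ≤ d`.
      nlinarith
  · have hlim : Tendsto (fun n : ℕ => ENNReal.ofReal (2 * C' / ε * (Real.sqrt n)⁻¹)) atTop
        (𝓝 0) := by
      rw [← ENNReal.ofReal_zero]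
      refine ENNReal.tendsto_ofReal ?_
      have := (tendsto_inv_atTop_zero.comp
        (Real.tendsto_sqrt_atTop.comp tendsto_natCast_atTop_atTop)).const_mul (2 * C' / ε)
      rwa [mul_zero] at this
    refine tendsto_of_tendsto_of_tendsto_of_le_of_le' tendsto_const_nhds hlim
      (Eventually.of_forall fun n => zero_le) ?_
    filter_upwards [eventually_ge_atTop 2] with n hn
    exact FiniteGame.measure_sqrt_mul_supFullDist_le hn
      (fun j => (hc n hn).measurableSet_apart hTmem j)
      (hbound' n hn (Ω n) (P n) (ℱ n) (X n) (Y n) (hc n hn)) hε
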